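/- **Abstraction DL.** Fix countably infinite sets of concept names, role names, variables and abstraction levels. $\mathcal{ALC}$-concepts are given by $C,D ::= A \mid \neg C \mid C\sqcap D \mid C\sqcup D \mid \exists r.C \mid \forall r.C$ with $A$ a concept name and $r$ a role name, interpreted as usual in interpretations with a non-empty domain ($\top$ abbreviates $A\sqcup\neg A$). A full conjunctive query $q(\bar x,\bar y)$ is a conjunction of atoms $C(z)$ and $r(z,z')$ with $C$ an $\mathcal{ALC}$-concept, $r$ a role name and all variables among the pairwise distinct variables of $\bar x,\bar y$; its answers on an interpretation $\mathcal I$ are the pairs $(h(\bar x),h(\bar y))$ for the variable assignments $h$ that make all atoms true in $\mathcal I$. An $\mathcal{ALC}^{\mathsf{abs}}[\mathrm{rr}]$-ontology is a finite set of labeled concept inclusions $C\sqsubseteq_L D$ and role refinements $L{:}q(\bar x,\bar y)\ \underline{\mathsf{refines}}\ L'{:}(C_1(x)\wedge r(x,y)\wedge C_2(y))$, where $L,L'$ are abstraction levels, $C,D,C_1,C_2$ are $\mathcal{ALC}$-concepts, $r$ is a role name and $q$ is a full conjunctive query. An A-interpretation consists of a set $\mathbf{A}_{\mathcal I}$ of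 abstraction levels; a relation $\prec$ on it such that the directed graph $(\mathbf{A}_{\mathcal I},\{(L',L)\mid L\prec L'\})$ is a (rooted) tree; an interpretation $\mathcal I_L$ for every $L\in\mathbf{A}_{\mathcal I}$, with pairwise disjoint domains; and a partial function $\rho$ that maps pairs $(d,L)$, where $d$ belongs to the domain of $\mathcal I_{L'}$ and $L\prec L'$, to non-empty tuples over the domain of $\mathcal I_L$, such that for every level $L$ and every $d$ in the domain of $\mathcal I_L$ there is at most one $e$ for which $d$ occurs in $\rho(e,L)$. It satisfies $C\sqsubseteq_L D$ if $L\in\mathbf{A}_{\mathcal I}$ and $C^{\mathcal I_L}\subseteq D^{\mathcal I_L}$; it satisfies the role refinement above if $L\prec L'$ and for all $d_1\in C_1^{\mathcal I_{L'}}$, $d_2\in C_2^{\mathcal I_{L'}}$ with $(d_1,d_2)\in r^{\mathcal I_{L'}}$ there is an answer $(\bar e_1,\bar e_2)$ to $q$ on $\mathcal I_L$ with $\rho(d_1,L)=\bar e_1$ and $\rho(d_2,L)=\bar e_2$. A model of an ontology is an A-interpretation that satisfies all its statements. Satisfiability in $\mathcal{ALC}^{\mathsf{abs}}[\mathrm{rr}]$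 is the problem to decide, given an $\mathcal{ALC}^{\mathsf{abs}}[\mathrm{rr}]$-ontology $\mathcal O$, an $\mathcal{ALC}$-concept $C$ and an abstraction level $L$ (written as a word over a finite alphabet), whether there is a model $\mathcal I$ of $\mathcal O$ with $L\in\mathbf{A}_{\mathcal I}$ and $C^{\mathcal I_L}\neq\emptyset$. **Theorem.** Satisfiability in $\mathcal{ALC}^{\mathsf{abs}}[\mathrm{rr}]$ is 2ExpTime-hard: every language over a finite alphabet that is decided by a deterministic Turing machine in time $2^{2^{p(n)}}$, for some polynomial $p$, is polynomial-time many-one reducible to it. -/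

import Mathlib

/-! ### Deterministic double exponential time and polynomial-time many-one reductions -/

/-- `L` is decided by a deterministic single-tape Turing machine with finite tape alphabet `Γ`
and finite state set `Λ` that, on every input `w`, halts after at most `T |w|` steps, and does so
in a state of the set `acc` exactly when `w ∈ L`.  The input is written on an otherwise blank tape
(the blank is `default : Γ`), its letters being represented by pairwise distinct nonblank tape
symbols. -/
def DecidableInTime {α : Type} (L : Language α) (T : ℕ → ℕ) : Prop :=
  ∃ (Γ Λ : Type) (_ : Inhabited Γ) (_ : Inhabited Λ) (_ : Finite Γ) (_ : Finite Λ)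
    (sym : α → Γ) (M : Turing.TM0.Machine Γ Λ) (acc : Set Λ),
    Function.Injective sym ∧ (∀ a, sym a ≠ default) ∧
    ∀ w : List α, ∃ (k : ℕ) (c : Turing.TM0.Cfg Γ Λ), k ≤ T w.length ∧
      (fun s : Option (Turing.TM0.Cfg Γ Λ) => s.bind (Turing.TM0.step M))^[k]
        (some (Turing.TM0.init (w.map sym))) = some c ∧
      Turing.TM0.step M c = none ∧ (c.q ∈ acc ↔ w ∈ L)

/-- The class 2ExpTime: decidable in time `2 ^ 2 ^ p(n)` for some polynomial `p`. -/
def InTwoExpTime {α : Type} (L : Language α) : Prop :=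
  ∃ p : Polynomial ℕ, DecidableInTime L (fun n => 2 ^ 2 ^ p.eval n)

/-- The language `L` is polynomial-time many-one reducible to the decision problem `P`, whose
instances are given to machines as words through `enc`. -/
def PolyTimeReducible {α ι S : Type} (L : Language α) (enc : ι → List S) (P : ι → Prop) : Prop :=
  ∃ f : List α → ι, Nonempty (Turing.TM2ComputableInPolyTime (id : List α → List α) enc f) ∧
    ∀ w : List α, w ∈ L ↔ P (f w)

/-- The decision problem `P` is 2ExpTime-hard: every language in 2ExpTime over every finite
alphabet is polynomial-time many-one reducible to it. -/
def TwoExpTimeHard {ι S : Type} (enc : ι → List S) (P : ι → Prop) : Prop :=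
  ∀ (α : Type) [Finite α] (L : Language α), InTwoExpTime L → PolyTimeReducible L enc P

namespace AbsDL

/-! ### Syntax -/

/-- Concept names, role names, variables and abstraction levels are words over `{0, 1}`; each of
these four sets of names is thus countably infinite. -/
abbrev Name : Type := List Bool

/-- ALC-concepts.  As usual, `⊤` stands for `A ⊔ ¬A` and `⊥` for `¬⊤`. -/
inductive Concept : Type
  | name (A : Name)
  | neg (C : Concept)
  | inter (C D : Concept)
  | union (C D : Concept)
  | ex (r : Name) (C : Concept)
  | all (r : Name) (C : Concept)

/-- Concept atoms `C(x)` and role atoms `r(x, y)`. -/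
inductive Atom : Type
  | concept (C : Concept) (x : Name)
  | role (r x y : Name)

/-- The variables of an atom. -/
def Atom.vars : Atom → List Name
  | .concept _ x => [x]
  | .role _ x y => [x, y]

/-- A full conjunctive query `q(x̄, ȳ)` whose tuple of (pairwise distinct) answer variables is
split into two tuples `x̄` and `ȳ`; it is full, that is, all its variables are answer variables.
The atom `⊤(x)` of an answer variable that occurs in no other atom need not be written. -/
structure CQ : Type where
  xs : List Name
  ys : List Name
  atoms : List Atom
  nodup : (xs ++ ys).Nodup
  full : ∀ a ∈ atoms, ∀ v ∈ a.vars, v ∈ xs ++ ys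

/-- The statements of ALC^abs[rr]: labeled concept inclusions `C ⊑_L D` and role refinements
`L:q(x̄, ȳ) refines L':C₁(x) ∧ r(x, y) ∧ C₂(y)`. -/
inductive Statement : Type
  | inclusion (L : Name) (C D : Concept)
  | roleRefinement (L : Name) (q : CQ) (L' : Name) (C₁ : Concept) (r : Name) (C₂ : Concept)

/-- An ALC^abs[rr]-ontology: a finite set of statements, given as a list. -/
abbrev Ontology : Type := List Statement

/-- Inputs of the satisfiability problem: an ontology, a concept and an abstraction level. -/
structure Instance : Type where
  ontology : Ontology
  concept : Concept
  level : Name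

/-! ### Semantics -/

/-- (Classical) interpretations. -/
structure Interp : Type 1 where
  Dom : Type
  nonempty : Nonempty Dom
  concept : Name → Set Dom
  role : Name → Dom → Dom → Prop

/-- The extension of a compound concept. -/
def Interp.ext (I : Interp) : Concept → Set I.Dom
  | .name A => I.concept A
  | .neg C => (I.ext C)ᶜ
  | .inter C D => I.ext C ∩ I.ext D
  | .union C D => I.ext C ∪ I.ext D
  | .ex r C => {d | ∃ e, I.role r d e ∧ e ∈ I.ext C}
  | .all r C => {d | ∀ e, I.role r d e → e ∈ I.ext C}

/-- The variable assignment `h` makes the atom true. -/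
def Interp.holds (I : Interp) (h : Name → I.Dom) : Atom → Prop
  | .concept C x => h x ∈ I.ext C
  | .role r x y => I.role r (h x) (h y)

/-- `(e₁, e₂)` is an answer to `q(x̄, ȳ)` on `I`. -/
def Interp.answer (I : Interp) (q : CQ) (e₁ e₂ : List I.Dom) : Prop :=
  ∃ h : Name → I.Dom, (∀ a ∈ q.atoms, I.holds h a) ∧ q.xs.map h = e₁ ∧ q.ys.map h = e₂

/-- The directed graph with node set `V` and edge relation `E` is a (rooted) tree: every node is
reachable from the root, the root has no incoming edge, every other node exactly one. -/
def IsDirectedTree {N : Type} (V : Set N) (E : N → N → Prop) : Prop :=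
  (∀ x y, E x y → x ∈ V ∧ y ∈ V) ∧
  ∃ r ∈ V, (∀ x, ¬ E x r) ∧ (∀ y ∈ V, y ≠ r → ∃! x, E x y) ∧
    ∀ y ∈ V, Relation.ReflTransGen E r y

/-- A-interpretations.  `prec L L'` says that `L` is finer than `L'`.  The value `int L` is
meaningful only for `L ∈ levels`.  The domains of distinct levels are kept apart by pairing an
object with its level, so they are disjoint. -/
structure AInterp : Type 1 where
  levels : Set Name
  prec : Name → Name → Prop
  tree : IsDirectedTree levels (fun L' L => prec L L')
  int : Name → Interp
  /-- the partial refinement function `ρ`: `ref L M d` is `ρ(d, L)` for an object `d` of level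
  `M` -/
  ref : ∀ L M : Name, (int M).Dom → Option (List (int L).Dom)
  ref_prec : ∀ L M d t, ref L M d = some t → prec L M
  ref_nonempty : ∀ L M d t, ref L M d = some t → t ≠ []
  /-- every object participates in at most one ensemble -/
  ref_unique : ∀ (L : Name) (d : (int L).Dom) (e e' : Σ M, (int M).Dom) t t',
    ref L e.1 e.2 = some t → d ∈ t → ref L e'.1 e'.2 = some t' → d ∈ t' → e = e'

/-- Satisfaction of a statement in an A-interpretation. -/
def AInterp.satisfies (I : AInterp) : Statement → Prop
  | .inclusion L C D => L ∈ I.levels ∧ (I.int L).ext C ⊆ (I.int L).ext D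
  | .roleRefinement L q L' C₁ r C₂ => I.prec L L' ∧
      ∀ d₁ d₂ : (I.int L').Dom,
        d₁ ∈ (I.int L').ext C₁ → (I.int L').role r d₁ d₂ → d₂ ∈ (I.int L').ext C₂ →
        ∃ e₁ e₂ : List (I.int L).Dom,
          (I.int L).answer q e₁ e₂ ∧ I.ref L L' d₁ = some e₁ ∧ I.ref L L' d₂ = some e₂

/-- `I` is a model of the ontology `O`. -/
def AInterp.isModel (I : AInterp) (O : Ontology) : Prop :=
  ∀ s ∈ O, I.satisfies s

/-- The concept of the instance is satisfiable on the level of the instance with respect to the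
ontology of the instance. -/
def Satisfiable (x : Instance) : Prop :=
  ∃ I : AInterp, I.isModel x.ontology ∧ x.level ∈ I.levels ∧
    ((I.int x.level).ext x.concept).Nonempty

/-! ### Writing instances as words over a finite alphabet -/

/-- The alphabet used to write instances. -/
inductive Sym : Type
  | bit (b : Bool)
  | fin | next
  | name | neg | inter | union | ex | all
  | conceptAtom | roleAtom | inclusion | roleRefinement
  deriving DecidableEq, Fintype

/-- A name is written as its letters followed by a terminator. -/
def encodeName (w : Name) : List Sym :=
  w.map Sym.bit ++ [Sym.fin]

/-- A list is written by writing `next` before each of its elements and a terminator at the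
end. -/
def encodeList {β : Type} (enc : β → List Sym) (l : List β) : List Sym :=
  l.flatMap (fun b => Sym.next :: enc b) ++ [Sym.fin]

/-- Concepts are written in prefix notation. -/
def encodeConcept : Concept → List Sym
  | .name A => Sym.name :: encodeName A
  | .neg C => Sym.neg :: encodeConcept C
  | .inter C D => Sym.inter :: (encodeConcept C ++ encodeConcept D)
  | .union C D => Sym.union :: (encodeConcept C ++ encodeConcept D)
  | .ex r C => Sym.ex :: (encodeName r ++ encodeConcept C)
  | .all r C => Sym.all :: (encodeName r ++ encodeConcept C)

/-- The word for an atom. -/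
def encodeAtom : Atom → List Sym
  | .concept C x => Sym.conceptAtom :: (encodeConcept C ++ encodeName x)
  | .role r x y => Sym.roleAtom :: (encodeName r ++ (encodeName x ++ encodeName y))

/-- The word for a conjunctive query. -/
def encodeCQ (q : CQ) : List Sym :=
  encodeList encodeName q.xs ++ (encodeList encodeName q.ys ++ encodeList encodeAtom q.atoms)

/-- The word for a statement. -/
def encodeStatement : Statement → List Sym
  | .inclusion L C D =>
      Sym.inclusion :: (encodeName L ++ (encodeConcept C ++ encodeConcept D))
  | .roleRefinement L q L' C₁ r C₂ =>
      Sym.roleRefinement :: (encodeName L ++ (encodeCQ q ++ (encodeName L' ++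
        (encodeConcept C₁ ++ (encodeName r ++ encodeConcept C₂)))))

/-- The word for an instance. -/
def encodeInstance (x : Instance) : List Sym :=
  encodeList encodeStatement x.ontology ++ (encodeConcept x.concept ++ encodeName x.level)

/-- Unique readability of a code, also in front of further symbols. -/
def Readable {β : Type} (enc : β → List Sym) : Prop :=
  ∀ a b s t, enc a ++ s = enc b ++ t → a = b ∧ s = t

theorem readable_name : Readable encodeName := by
  intro a
  induction a with
  | nil =>
    intro b s t h
    cases b <;> simp_all [encodeName]
  | cons x a ih =>
    intro b s t h
    cases b with
    | nil => simp [encodeName] at h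
    | cons y b =>
      have := ih b s t
      simp_all [encodeName]

theorem readable_list {β : Type} {enc : β → List Sym} (he : Readable enc) :
    Readable (encodeList enc) := by
  intro a
  induction a with
  | nil =>
    intro b s t h
    cases b <;> simp_all [encodeList]
  | cons x a ih =>
    intro b s t h
    cases b with
    | nil => simp [encodeList] at h
    | cons y b =>
      simp only [encodeList, List.flatMap_cons, List.cons_append, List.append_assoc,
        List.cons.injEq, true_and] at h
      obtain ⟨rfl, h⟩ := he _ _ _ _ h
      have := ih b s t (by simpa [encodeList] using h)
      simp_all

theorem readable_concept : Readable encodeConcept := by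
  intro a
  induction a with
  | name A =>
    intro b s t h
    cases b <;> simp [encodeConcept] at h
    have := readable_name _ _ _ _ h
    simp_all
  | neg C ih =>
    intro b s t h
    cases b <;> simp [encodeConcept] at h
    have := ih _ _ _ h
    simp_all
  | inter C D ihC ihD | union C D ihC ihD =>
    intro b s t h
    cases b <;> simp [encodeConcept] at h
    obtain ⟨rfl, h1⟩ := ihC _ _ _ h
    have := ihD _ _ _ h1
    simp_all
  | ex r C ih | all r C ih =>
    intro b s t h
    cases b <;> simp [encodeConcept] at h
    obtain ⟨rfl, h1⟩ := readable_name _ _ _ _ h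
    have := ih _ _ _ h1
    simp_all

theorem readable_atom : Readable encodeAtom := by
  intro a b s t h
  cases a <;> cases b <;> simp [encodeAtom] at h
  · obtain ⟨rfl, h1⟩ := readable_concept _ _ _ _ h
    have := readable_name _ _ _ _ h1
    simp_all
  · obtain ⟨rfl, h1⟩ := readable_name _ _ _ _ h
    obtain ⟨rfl, h2⟩ := readable_name _ _ _ _ h1
    have := readable_name _ _ _ _ h2
    simp_all

theorem readable_cq : Readable encodeCQ := by
  rintro ⟨xs, ys, as, h₁, h₂⟩ ⟨xs', ys', as', h₁', h₂'⟩ s t h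
  simp only [encodeCQ, List.append_assoc] at h
  obtain ⟨rfl, h1⟩ := readable_list readable_name _ _ _ _ h
  obtain ⟨rfl, h2⟩ := readable_list readable_name _ _ _ _ h1
  obtain ⟨rfl, h3⟩ := readable_list readable_atom _ _ _ _ h2
  exact ⟨rfl, h3⟩

theorem readable_statement : Readable encodeStatement := by
  intro a b s t h
  cases a <;> cases b <;> simp [encodeStatement] at h
  · obtain ⟨rfl, h1⟩ := readable_name _ _ _ _ h
    obtain ⟨rfl, h2⟩ := readable_concept _ _ _ _ h1
    obtain ⟨rfl, h3⟩ := readable_concept _ _ _ _ h2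
    exact ⟨rfl, h3⟩
  · obtain ⟨rfl, h1⟩ := readable_name _ _ _ _ h
    obtain ⟨rfl, h2⟩ := readable_cq _ _ _ _ h1
    obtain ⟨rfl, h3⟩ := readable_name _ _ _ _ h2
    obtain ⟨rfl, h4⟩ := readable_concept _ _ _ _ h3
    obtain ⟨rfl, h5⟩ := readable_name _ _ _ _ h4
    obtain ⟨rfl, h6⟩ := readable_concept _ _ _ _ h5
    exact ⟨rfl, h6⟩

/-- Distinct instances are written as distinct words. -/
theorem encodeInstance_injective : Function.Injective encodeInstance := by
  rintro ⟨O, C, L⟩ ⟨O', C', L'⟩ h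
  simp only [encodeInstance] at h
  obtain ⟨rfl, h1⟩ := readable_list readable_statement _ _ _ _ h
  obtain ⟨rfl, h2⟩ := readable_concept _ _ _ _ h1
  obtain ⟨rfl, -⟩ := readable_name L L' [] [] (by simpa using h2)
  rfl

end AbsDL

namespace AbsDL

/-! ### Binary counters -/

/-! A run of length at most `2 ^ 2 ^ p(n)` is simulated by a cellular automaton on a cyclic tape
with `2 ^ 2 ^ N` cells, where `N` is polynomial in `n`. The instance is satisfiable exactly if some
cell of the space-time diagram has an accepting content.

The ontology has levels `0, …, N`, with `N` the coarsest. On level `N` an object stands for a cell,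
that is, a pair of a time and a position, both numbers modulo `2 ^ 2 ^ N`. Such a number needs `2 ^
N` bits, which are supplied by refinement: an object with an incoming `row` edge is refined to a
pair on the next level, each component again to a pair, and so on down to `2 ^ N` objects on level
`0`, one for each bit position. Since `ρ` is a function, all role refinements that concern an object
speak of the same ensemble. Therefore `rowRule` turns a `row` edge into bitwise `row` edges,
`rowRule` and `chainRule` together link the bits into a chain, and the transport rules carry flags
from level `N` to all bits, to the first or to the last one. Decrementing is then a local condition
on level `0`: a flag passed along the chain records that all lower bits vanish, and each bit is
flipped or copied along its `row` edge (`low_iff`, `stores_succ`).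

Counters are only ever decremented. The cell `(t + 1, q)` reaches `(t, q)`, `(t, q - 1)` and `(t, q
- 2)` along one path of three edges, so the automaton moves everything one cell to the right in each
step. Different objects may stand for the same cell without being compared, and this is harmless:
the automaton is deterministic, so induction on `t` forces every content to be the true one
(`cell_eq_conf`). At time `0` the concept `inputC`, of size linear in the input, decrements the
position while carrying the tape symbol along, until the position is zero or the input is exhausted
(`sym_eq_of_inputC`).

Conversely, `runModel` uses on every level the same nodes, paired with an index `j`; the pair `(x,
j)` is refined to `(x, 2 * j)` and `(x, 2 * j + 1)`, and all contents are read off the actual run.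

The automaton follows the machine as long as the relevant part of the tape does not wrap around
(`conf_mem_haltedIn_iff`). As levels have unary names, the word for the instance consists of fixed
words, one word for each input letter, and one block for each level. A small loop language, compiled
to stack machines, outputs it in polynomial time (`nonempty_computableInPolyTime_reduction`). -/

theorem testBit_pred (n j : ℕ) :
    n.testBit j = true ↔
      ¬ ((n + 1).testBit j = true ↔ ∀ k < j, (n + 1).testBit k = false) := by
  have h : (∀ k < j, (n + 1).testBit k = false) ↔ (n + 1) % 2 ^ j = 0 := by
    constructor
    · intro h
      apply Nat.eq_of_testBit_eq
      intro i
      rw [Nat.testBit_mod_two_pow]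
      by_cases hi : i < j
      · simp [h i hi]
      · simp [hi]
    · intro h k hk
      have := congrArg (fun m => m.testBit k) h
      simpa [Nat.testBit_mod_two_pow, hk] using this
  rw [h]
  simp only [Nat.testBit_eq_decide_div_mod_eq, decide_eq_true_eq]
  have hp : 0 < 2 ^ j := by positivity
  generalize 2 ^ j = p at *
  -- Bit `j` is the parity of the quotient by `2 ^ j`, and this quotient grows from `n` to `n + 1`
  -- exactly if `2 ^ j` divides `n + 1`.
  rw [Nat.succ_div]
  generalize n / p = m
  split_ifs with h1 <;> rw [Nat.dvd_iff_mod_eq_zero] at h1 <;>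
    simp only [h1, iff_true, iff_false, not_not, add_zero]
  omega

variable {M : ℕ}

/-- Subtraction of one flips a bit exactly if all lower bits are zero. The rule survives the
wrap-around at `0`, where every one of the `M` bits is flipped. -/
theorem testBit_val_sub_one (v : ZMod (2 ^ M)) {j : ℕ} (hj : j < M) :
    (v - 1).val.testBit j = true ↔
      ¬ (v.val.testBit j = true ↔ ∀ k < j, v.val.testBit k = false) := by
  have hM : 1 < 2 ^ M := Nat.one_lt_two_pow (by omega)
  have : Fact (1 < 2 ^ M) := ⟨hM⟩
  by_cases hv : v = 0
  · subst hv
    have : (0 - 1 : ZMod (2 ^ M)).val = 2 ^ M - 1 := by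
      rw [zero_sub, ZMod.val_neg_of_ne_zero, ZMod.val_one]
    rw [this]
    simp [Nat.testBit_two_pow_sub_one, hj]
  · have h0 : v.val ≠ 0 := by rwa [Ne, ZMod.val_eq_zero]
    have : v.val = (v - 1).val + 1 := by
      rw [ZMod.val_sub (by rw [ZMod.val_one]; omega), ZMod.val_one]
      omega
    rw [this]
    exact testBit_pred _ _

theorem exists_val_testBit (b : ℕ → Prop) :
    ∃ v : ZMod (2 ^ M), ∀ j < M, v.val.testBit j = true ↔ b j := by
  classical
  refine ⟨(Nat.ofBits (fun i : Fin M => decide (b i)) : ℕ), fun j hj => ?_⟩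
  rw [ZMod.val_natCast_of_lt (Nat.ofBits_lt_two_pow _), Nat.testBit_ofBits_lt _ _ hj]
  simp

theorem eq_of_val_testBit {v w : ZMod (2 ^ M)}
    (h : ∀ j < M, v.val.testBit j = true ↔ w.val.testBit j = true) : v = w := by
  apply ZMod.val_injective
  apply Nat.eq_of_testBit_eq
  intro j
  by_cases hj : j < M
  · exact Bool.eq_iff_iff.2 (h j hj)
  · have hp : 2 ^ M ≤ 2 ^ j := Nat.pow_le_pow_right (by omega) (by omega)
    rw [Nat.testBit_lt_two_pow (lt_of_lt_of_le (ZMod.val_lt v) hp),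
      Nat.testBit_lt_two_pow (lt_of_lt_of_le (ZMod.val_lt w) hp)]

theorem eq_zero_of_val_testBit {v : ZMod (2 ^ M)}
    (h : ∀ j < M, v.val.testBit j = false) : v = 0 :=
  eq_of_val_testBit fun j hj => by simp [h j hj]

end AbsDL

/-! ### The ontology of the reduction -/

namespace AbsDL

/-! ### Derived concept constructors -/

/-- The concept `⊤`. -/
def Concept.top : Concept := .union (.name []) (.neg (.name []))

/-- The concept `⊥`. -/
def Concept.bot : Concept := .neg .top

/-- Finite disjunctions. -/
def Concept.disj (l : List Concept) : Concept := l.foldr .union .bot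

namespace Interp

variable (I : Interp) {d : I.Dom}

theorem mem_ext_top : d ∈ I.ext .top := Classical.em _

theorem mem_ext_union {C D : Concept} :
    d ∈ I.ext (.union C D) ↔ d ∈ I.ext C ∨ d ∈ I.ext D := Iff.rfl

theorem mem_ext_bot : d ∈ I.ext .bot ↔ False :=
  ⟨fun h => h I.mem_ext_top, False.elim⟩

theorem mem_ext_disj {l : List Concept} : d ∈ I.ext (.disj l) ↔ ∃ C ∈ l, d ∈ I.ext C := by
  induction l with
  | nil => simp [Concept.disj, mem_ext_bot]
  | cons C l ih =>
    have : Concept.disj (C :: l) = .union C (.disj l) := rfl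
    rw [this, mem_ext_union, ih]
    simp

end Interp

/-! ### Signature -/

/-- The concept names of the reduction: counter bits, the flags "all lower bits are zero",
"decremented along the incoming edge", "is zero" and "is positive" for two counters, the first
bit, the first row, objects that look up the input, tape symbols, and cell contents. -/
inductive Sig (Γ S : Type) : Type
  | bit (c : Bool) | low (c : Bool) | dec (c : Bool) | zero (c : Bool) | pos (c : Bool)
  | first | start | walk
  | sym (a : Γ) | cell (s : S)

variable {Γ S : Type}

/-- An injection of the signature into a product of countable types. -/
def Sig.code : Sig Γ S → ℕ × Bool × Option Γ × Option S
  | bit c => (0, c, none, none)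
  | low c => (1, c, none, none)
  | dec c => (2, c, none, none)
  | zero c => (3, c, none, none)
  | pos c => (4, c, none, none)
  | first => (5, false, none, none)
  | start => (6, false, none, none)
  | walk => (7, false, none, none)
  | sym a => (8, false, some a, none)
  | cell s => (9, false, none, some s)

theorem Sig.code_injective : Function.Injective (Sig.code : Sig Γ S → _) := by
  intro a b h
  cases a <;> cases b <;> simp_all [Sig.code]

instance [Countable Γ] [Countable S] : Countable (Sig Γ S) :=
  Sig.code_injective.countable

/-- The word `1ⁿ`. -/
def unary (n : ℕ) : Name := List.replicate n true

theorem unary_injective : Function.Injective unary := fun a b h => by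
  simpa [unary] using congrArg List.length h

variable [Finite Γ] [Finite S]

/-- The word that is the concept name for an element of the signature. -/
noncomputable def nm (v : Sig Γ S) : Name :=
  unary ((Countable.exists_injective_nat (Sig Γ S)).choose v)

theorem nm_injective : Function.Injective (nm : Sig Γ S → Name) :=
  unary_injective.comp (Countable.exists_injective_nat (Sig Γ S)).choose_spec

/-- The atomic concept for an element of the signature. -/
noncomputable def nmC (v : Sig Γ S) : Concept := .name (nm v)

/-- The role between the object of a node and that of its successor. -/
def row : Name := []

/-- The role between consecutive bits of a counter. -/
def chain : Name := [true]

/-! ### Refinement rules -/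

/-- A role refinement without its levels. -/
structure Rule : Type where
  q : CQ
  source : Concept
  role : Name
  target : Concept

/-- The role refinement between the levels `i` and `i + 1`. -/
def Rule.toStatement (R : Rule) (i : ℕ) : Statement :=
  .roleRefinement (unary i) R.q (unary (i + 1)) R.source R.role R.target

/-- First component of the first ensemble. -/
def x₁ : Name := []
/-- Second component of the first ensemble. -/
def x₂ : Name := [true]
/-- First component of the second ensemble. -/
def y₁ : Name := [false]
/-- Second component of the second ensemble. -/
def y₂ : Name := [false, true]

/-- The query with ensembles `(x₁, x₂)`, `(y₁, y₂)` and the given atoms. -/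
def pairCQ (l : List Atom) (h : ∀ a ∈ l, ∀ v ∈ a.vars, v ∈ [x₁, x₂] ++ [y₁, y₂]) : CQ where
  xs := [x₁, x₂]
  ys := [y₁, y₂]
  atoms := l
  nodup := by decide
  full := h

/-- Edges between nodes are refined componentwise, and ensembles are chains. -/
def rowRule : Rule where
  q := pairCQ [.role row x₁ y₁, .role row x₂ y₂, .role chain y₁ y₂] (by
    simp [Atom.vars])
  source := .top
  role := row
  target := .top

/-- Consecutive ensembles are joined into a chain. -/
def chainRule : Rule where
  q := pairCQ [.role chain x₂ y₁] (by simp [Atom.vars])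
  source := .top
  role := chain
  target := .top

/-- A concept name is passed on to the first or to the second component, or to both. -/
def transportRule (A : Name) (b₁ b₂ : Bool) : Rule where
  q := pairCQ ((if b₁ then [.concept (.name A) y₁] else []) ++
      (if b₂ then [.concept (.name A) y₂] else [])) (by
    cases b₁ <;> cases b₂ <;> simp [Atom.vars])
  source := .top
  role := row
  target := .name A

variable (Γ S) in
/-- All refinement rules. -/
noncomputable def rules : List Rule :=
  [rowRule, chainRule, transportRule (nm (Sig.first : Sig Γ S)) true false] ++
    [false, true].flatMap fun c =>
      [transportRule (nm (Sig.dec c : Sig Γ S)) true true,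
        transportRule (nm (Sig.zero c : Sig Γ S)) true true,
        transportRule (nm (Sig.pos c : Sig Γ S)) false true]

/-! ### Concept inclusions on the finest level -/

variable (Γ S) in
/-- The bit of the counter `c` and the flag for its lower bits agree. -/
noncomputable def sameC (c : Bool) : Concept :=
  .union (.inter (nmC (Sig.bit c : Sig Γ S)) (nmC (Sig.low c : Sig Γ S)))
    (.inter (.neg (nmC (Sig.bit c : Sig Γ S))) (.neg (nmC (Sig.low c : Sig Γ S))))

variable (Γ S) in
/-- The bit of the counter `c` is zero, and so are all lower bits. -/
noncomputable def lowZeroC (c : Bool) : Concept :=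
  .inter (nmC (Sig.low c : Sig Γ S)) (.neg (nmC (Sig.bit c : Sig Γ S)))

variable (Γ S) in
/-- The behaviour of the counter `c`. -/
noncomputable def counterInclusions (c : Bool) : List (Concept × Concept) :=
  [(nmC (Sig.first : Sig Γ S), nmC (Sig.low c : Sig Γ S)),
    (lowZeroC Γ S c, .all chain (nmC (Sig.low c : Sig Γ S))),
    (.neg (lowZeroC Γ S c), .all chain (.neg (nmC (Sig.low c : Sig Γ S)))),
    (nmC (Sig.zero c : Sig Γ S), .neg (nmC (Sig.bit c : Sig Γ S))),
    (nmC (Sig.pos c : Sig Γ S),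
      .union (.neg (nmC (Sig.low c : Sig Γ S))) (nmC (Sig.bit c : Sig Γ S))),
    (.neg (sameC Γ S c), .all row (.union (.neg (nmC (Sig.dec c : Sig Γ S)))
      (nmC (Sig.bit c : Sig Γ S)))),
    (sameC Γ S c, .all row (.union (.neg (nmC (Sig.dec c : Sig Γ S)))
      (.neg (nmC (Sig.bit c : Sig Γ S))))),
    (nmC (Sig.bit c : Sig Γ S), .all row (.union (.neg (nmC (Sig.dec (!c) : Sig Γ S)))
      (nmC (Sig.bit c : Sig Γ S)))),
    (.neg (nmC (Sig.bit c : Sig Γ S)), .all row (.union (.neg (nmC (Sig.dec (!c) : Sig Γ S)))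
      (.neg (nmC (Sig.bit c : Sig Γ S)))))]

variable (Γ S) in
/-- The concept inclusions on the finest level. -/
noncomputable def bottomInclusions : List (Concept × Concept) :=
  [false, true].flatMap (counterInclusions Γ S)

/-! ### Concept inclusions on the coarsest level -/

/-- A one-dimensional cellular automaton whose cells depend on three cells of the preceding row,
together with the contents of the cells of the first row. -/
structure Automaton (Γ S : Type) : Type where
  blank : Γ
  init : Bool → Γ → S
  next : S → S → S → S

/-- The content of the cell `q` at time `t` if the automaton is run on a cyclic tape. -/
def Automaton.conf (A : Automaton Γ S) (K : ℕ) (u : List Γ) : ℕ → ZMod K → S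
  | 0, q => A.init (decide (q = 0)) (u.getD q.val A.blank)
  | t + 1, q => A.next (A.conf K u t (q - 1 - 1)) (A.conf K u t (q - 1)) (A.conf K u t q)

/-- All elements of a finite type. -/
noncomputable def elems (X : Type) [Finite X] : List X :=
  (@Finset.univ X (Fintype.ofFinite X)).toList

theorem mem_elems {X : Type} [Finite X] (x : X) : x ∈ elems X := by
  simp [elems]

variable (Γ) in
/-- There is a successor in which the counter `c` is decremented and that is in the cell with
content `s` and in `C`. -/
noncomputable def succC (c : Bool) (s : S) (C : Concept) : Concept :=
  .ex row (.inter (nmC (Sig.dec c : Sig Γ S)) (.inter (nmC (Sig.cell s : Sig Γ S)) C))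

/-- The cell with content `s` belongs to the first row and is correct. -/
noncomputable def initC (A : Automaton Γ S) (s : S) : Concept :=
  .disj (((elems (Bool × Γ)).filter (fun p => @decide (A.init p.1 p.2 = s)
      (Classical.propDecidable _))).map fun p =>
    .inter (nmC (Sig.sym p.2 : Sig Γ S))
      (nmC (if p.1 then Sig.zero true else Sig.pos true : Sig Γ S)))

/-- The cell with content `s` has correct predecessors. -/
noncomputable def nextC (A : Automaton Γ S) (s : S) : Concept :=
  .disj (((elems (S × S × S)).filter (fun p => @decide (A.next p.1 p.2.1 p.2.2 = s)
      (Classical.propDecidable _))).map fun p =>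
    succC Γ false p.2.2 (succC Γ true p.2.1 (succC Γ true p.1 .top)))

/-- The condition on a cell with content `s`; the counter `false` is the time, the counter `true`
is the position. -/
noncomputable def cellInclusion (A : Automaton Γ S) (s : S) : Concept × Concept :=
  (nmC (Sig.cell s : Sig Γ S),
    .union (.inter (nmC (Sig.zero false : Sig Γ S))
        (.inter (nmC (Sig.start : Sig Γ S)) (initC A s)))
      (.inter (nmC (Sig.pos false : Sig Γ S)) (nextC A s)))

variable (S) in
/-- Tape symbols are passed on while looking up the input. -/
noncomputable def walkInclusion (a : Γ) : Concept × Concept :=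
  (nmC (Sig.sym a : Sig Γ S),
    .all row (.union (.neg (nmC (Sig.walk : Sig Γ S))) (nmC (Sig.sym a : Sig Γ S))))

variable (S) in
/-- Tape symbols are unique. -/
noncomputable def uniqueInclusion (p : Γ × Γ) : Concept × Concept :=
  (.inter (nmC (Sig.sym p.1 : Sig Γ S)) (nmC (Sig.sym p.2 : Sig Γ S)), .bot)

/-- The concept inclusions on the coarsest level that do not depend on the input. -/
noncomputable def topInclusions (A : Automaton Γ S) : List (Concept × Concept) :=
  (.top, .all row (nmC (Sig.first : Sig Γ S))) ::
    ((elems S).map (cellInclusion A) ++ ((elems Γ).map (walkInclusion S) ++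
      ((elems (Γ × Γ)).filter (fun p => @decide (p.1 ≠ p.2) (Classical.propDecidable _))).map
        (uniqueInclusion S)))

variable (S) in
/-- The tape symbol is the one at the given position of the input. -/
noncomputable def inputC (blank : Γ) : List Γ → Concept
  | [] => nmC (Sig.sym blank : Sig Γ S)
  | a :: u => .union (.inter (nmC (Sig.zero true : Sig Γ S)) (nmC (Sig.sym a : Sig Γ S)))
      (.inter (nmC (Sig.pos true : Sig Γ S)) (.ex row (.inter (nmC (Sig.dec true : Sig Γ S))
        (.inter (nmC (Sig.walk : Sig Γ S)) (inputC blank u)))))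

variable (Γ) in
/-- There is a successor whose content belongs to `F`. -/
noncomputable def queryC (F : Set S) : Concept :=
  .ex row (.disj (((elems S).filter (fun s => @decide (s ∈ F) (Classical.propDecidable _))).map
    fun s => nmC (Sig.cell s : Sig Γ S)))

/-! ### The instance -/

/-- The concept inclusion on the level `i`. -/
def inclusionAt (i : ℕ) (p : Concept × Concept) : Statement :=
  .inclusion (unary i) p.1 p.2

/-- An instance with the levels `0, …, N`, given by concept inclusions on the levels `0` and `N`
and by rules for consecutive levels. -/
def layered (bots : List (Concept × Concept)) (R : List Rule) (tops : List (Concept × Concept))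
    (p : Concept × Concept) (C : Concept) (N : ℕ) : Instance where
  ontology := bots.map (inclusionAt 0) ++ ((List.range N).flatMap (fun i =>
    R.map (Rule.toStatement · i)) ++ (tops.map (inclusionAt N) ++ [inclusionAt N p]))
  concept := C
  level := unary N

/-- The instance for a run of the automaton `A` on the word `u`. -/
noncomputable def reduction (A : Automaton Γ S) (F : Set S) (u : List Γ) (N : ℕ) : Instance :=
  layered (bottomInclusions Γ S) (rules Γ S) (topInclusions A)
    (nmC (Sig.start : Sig Γ S), inputC S A.blank u) (queryC Γ F) N

end AbsDL

namespace AbsDL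

variable {Γ S : Type}

/-! ### From models to runs of the automaton -/

/-- `e 0, …, e (2 ^ m - 1)` are the objects of level `0` that the object `y` of level `m` is
refined to. -/
def AInterp.Unfolds (I : AInterp) :
    (m : ℕ) → (I.int (unary m)).Dom → (ℕ → (I.int (unary 0)).Dom) → Prop
  | 0, y, e => e 0 = y
  | m + 1, y, e => ∃ y₀ y₁, I.ref (unary m) (unary (m + 1)) y = some [y₀, y₁] ∧
      I.Unfolds m y₀ e ∧ I.Unfolds m y₁ (fun j => e (j + 2 ^ m))

/-- Only the first `2 ^ m` values matter. -/
theorem AInterp.Unfolds.congr {I : AInterp} {m : ℕ} {y : (I.int (unary m)).Dom}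
    {e e' : ℕ → (I.int (unary 0)).Dom} (h : I.Unfolds m y e) (he : ∀ j < 2 ^ m, e j = e' j) :
    I.Unfolds m y e' := by
  induction m generalizing e e' with
  | zero => exact (he 0 (by simp)).symm.trans h
  | succ m ih =>
    obtain ⟨y₀, y₁, hr, h₀, h₁⟩ := h
    refine ⟨y₀, y₁, hr, ih h₀ fun j hj => he j (by rw [pow_succ]; omega),
      ih h₁ fun j hj => he _ (by rw [pow_succ]; omega)⟩

/-- The condition that the row rule imposes on consecutive levels. -/
def AInterp.RowRefines (I : AInterp) (m : ℕ) : Prop :=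
  ∀ x y, (I.int (unary (m + 1))).role row x y → ∃ x₀ x₁ y₀ y₁,
    I.ref (unary m) (unary (m + 1)) x = some [x₀, x₁] ∧
    I.ref (unary m) (unary (m + 1)) y = some [y₀, y₁] ∧
    (I.int (unary m)).role row x₀ y₀ ∧ (I.int (unary m)).role row x₁ y₁ ∧
    (I.int (unary m)).role chain y₀ y₁

/-- The condition that the chain rule imposes on consecutive levels. -/
def AInterp.ChainRefines (I : AInterp) (m : ℕ) : Prop :=
  ∀ x y, (I.int (unary (m + 1))).role chain x y → ∃ x₀ x₁ y₀ y₁,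
    I.ref (unary m) (unary (m + 1)) x = some [x₀, x₁] ∧
    I.ref (unary m) (unary (m + 1)) y = some [y₀, y₁] ∧
    (I.int (unary m)).role chain x₁ y₀

/-- The condition that a transport rule imposes on consecutive levels. -/
def AInterp.Transports (I : AInterp) (A : Name) (b₁ b₂ : Bool) (m : ℕ) : Prop :=
  ∀ x y, (I.int (unary (m + 1))).role row x y → y ∈ (I.int (unary (m + 1))).concept A →
    ∃ y₀ y₁, I.ref (unary m) (unary (m + 1)) y = some [y₀, y₁] ∧
      (b₁ = true → y₀ ∈ (I.int (unary m)).concept A) ∧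
      (b₂ = true → y₁ ∈ (I.int (unary m)).concept A)

theorem AInterp.rowRefines_of_satisfies {I : AInterp} {m : ℕ}
    (h : I.satisfies (rowRule.toStatement m)) : I.RowRefines m := by
  intro x y hxy
  obtain ⟨e₁, e₂, ⟨g, hg, rfl, rfl⟩, hx, hy⟩ :=
    h.2 x y (Interp.mem_ext_top _) hxy (Interp.mem_ext_top _)
  simp only [rowRule, pairCQ, List.mem_cons, List.not_mem_nil, or_false, forall_eq_or_imp,
    forall_eq, Interp.holds] at hg
  exact ⟨g x₁, g x₂, g y₁, g y₂, hx, hy, hg.1, hg.2.1, hg.2.2⟩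

theorem AInterp.chainRefines_of_satisfies {I : AInterp} {m : ℕ}
    (h : I.satisfies (chainRule.toStatement m)) : I.ChainRefines m := by
  intro x y hxy
  obtain ⟨e₁, e₂, ⟨g, hg, rfl, rfl⟩, hx, hy⟩ :=
    h.2 x y (Interp.mem_ext_top _) hxy (Interp.mem_ext_top _)
  simp only [chainRule, pairCQ, List.mem_cons, List.not_mem_nil, or_false,
    forall_eq, Interp.holds] at hg
  exact ⟨g x₁, g x₂, g y₁, g y₂, hx, hy, hg⟩

theorem AInterp.transports_of_satisfies {I : AInterp} {A : Name} {b₁ b₂ : Bool} {m : ℕ}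
    (h : I.satisfies ((transportRule A b₁ b₂).toStatement m)) : I.Transports A b₁ b₂ m := by
  intro x y hxy hA
  obtain ⟨e₁, e₂, ⟨g, hg, rfl, rfl⟩, hx, hy⟩ :=
    h.2 x y (Interp.mem_ext_top _) hxy hA
  refine ⟨g y₁, g y₂, hy, ?_, ?_⟩
  · rintro rfl
    exact hg (.concept (.name A) y₁) (by simp [transportRule, pairCQ])
  · rintro rfl
    exact hg (.concept (.name A) y₂) (by simp [transportRule, pairCQ])

/-! ### Propagation of edges and flags from coarse levels to level `0` -/

section Unfold

variable {I : AInterp} {N : ℕ}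

/-- The row rule only asserts that some ensembles are linked componentwise; as `ref` is a function,
these are the ensembles used in the given unfoldings. The index `j` lies in the left or in the right
half, and induction applies to that half. -/
theorem AInterp.Unfolds.row (hr : ∀ m < N, I.RowRefines m) {m : ℕ} (hm : m ≤ N)
    {x y : (I.int (unary m)).Dom} {e e' : ℕ → (I.int (unary 0)).Dom}
    (hxy : (I.int (unary m)).role row x y) (hx : I.Unfolds m x e) (hy : I.Unfolds m y e')
    {j : ℕ} (hj : j < 2 ^ m) : (I.int (unary 0)).role AbsDL.row (e j) (e' j) := by
  induction m generalizing e e' j with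
  | zero =>
    obtain rfl : j = 0 := by simpa using hj
    rw [show e 0 = x from hx, show e' 0 = y from hy]
    exact hxy
  | succ m ih =>
    obtain ⟨a₀, a₁, b₀, b₁, ha, hb, h₀, h₁, -⟩ := hr m hm x y hxy
    obtain ⟨c₀, c₁, hc, hc₀, hc₁⟩ := hx
    obtain ⟨d₀, d₁, hd, hd₀, hd₁⟩ := hy
    obtain ⟨rfl, rfl⟩ : a₀ = c₀ ∧ a₁ = c₁ := by simpa [ha] using hc
    obtain ⟨rfl, rfl⟩ : b₀ = d₀ ∧ b₁ = d₁ := by simpa [hb] using hd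
    by_cases hjm : j < 2 ^ m
    · exact ih (by omega) h₀ hc₀ hd₀ hjm
    · have := ih (by omega) h₁ hc₁ hd₁ (j := j - 2 ^ m) (by rw [pow_succ] at hj; omega)
      simpa only [Nat.sub_add_cancel (not_lt.1 hjm)] using this

/-- On each level the chain rule links the second component of the first ensemble to the first
component of the second, so the link ends up between the rightmost leaf below `x` and the leftmost
leaf below `y`. -/
theorem AInterp.Unfolds.chain_join (hc : ∀ m < N, I.ChainRefines m) {m : ℕ} (hm : m ≤ N)
    {x y : (I.int (unary m)).Dom} {e e' : ℕ → (I.int (unary 0)).Dom}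
    (hxy : (I.int (unary m)).role chain x y) (hx : I.Unfolds m x e) (hy : I.Unfolds m y e') :
    (I.int (unary 0)).role chain (e (2 ^ m - 1)) (e' 0) := by
  induction m generalizing e e' with
  | zero =>
    have h1 : e 0 = x := hx
    rw [show e' 0 = y from hy]
    simpa [h1] using hxy
  | succ m ih =>
    obtain ⟨a₀, a₁, b₀, b₁, ha, hb, h⟩ := hc m hm x y hxy
    obtain ⟨c₀, c₁, hc, hc₀, hc₁⟩ := hx
    obtain ⟨d₀, d₁, hd, hd₀, hd₁⟩ := hy
    obtain ⟨rfl, rfl⟩ : a₀ = c₀ ∧ a₁ = c₁ := by simpa [ha] using hc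
    obtain ⟨rfl, rfl⟩ : b₀ = d₀ ∧ b₁ = d₁ := by simpa [hb] using hd
    have := ih (by omega) h hc₁ hd₀
    have hp : 0 < 2 ^ m := by positivity
    rwa [show 2 ^ m - 1 + 2 ^ m = 2 ^ (m + 1) - 1 by rw [pow_succ]; omega] at this

/-- Induction handles both halves, and `chain_join` the seam between them. The incoming `row` edge
is needed because the row rule links the two components only in the ensemble of the target. -/
theorem AInterp.Unfolds.chain (hr : ∀ m < N, I.RowRefines m) (hc : ∀ m < N, I.ChainRefines m)
    {m : ℕ} (hm : m ≤ N) {x y : (I.int (unary m)).Dom} {e : ℕ → (I.int (unary 0)).Dom}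
    (hxy : (I.int (unary m)).role AbsDL.row x y) (hy : I.Unfolds m y e)
    {j : ℕ} (hj : j + 1 < 2 ^ m) :
    (I.int (unary 0)).role AbsDL.chain (e j) (e (j + 1)) := by
  induction m generalizing e j with
  | zero => simp at hj
  | succ m ih =>
    obtain ⟨a₀, a₁, b₀, b₁, ha, hb, h₀, h₁, h₂⟩ := hr m hm x y hxy
    obtain ⟨d₀, d₁, hd, hd₀, hd₁⟩ := hy
    obtain ⟨rfl, rfl⟩ : b₀ = d₀ ∧ b₁ = d₁ := by simpa [hb] using hd
    rw [pow_succ] at hj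
    rcases lt_trichotomy (j + 1) (2 ^ m) with hjm | hjm | hjm
    · exact ih (by omega) h₀ hd₀ hjm
    · have := hd₀.chain_join hc (by omega) h₂ hd₁
      simp only [zero_add, ← hjm] at this
      simpa using this
    · have := ih (by omega) h₁ hd₁ (j := j - 2 ^ m) (by omega)
      rw [show j - 2 ^ m + 2 ^ m = j by omega, show j - 2 ^ m + 1 + 2 ^ m = j + 1 by omega] at this
      exact this

theorem AInterp.exists_unfolds (hr : ∀ m < N, I.RowRefines m) {m : ℕ} (hm : m ≤ N)
    {x y : (I.int (unary m)).Dom} (hxy : (I.int (unary m)).role row x y) :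
    (∃ e, I.Unfolds m x e) ∧ ∃ e, I.Unfolds m y e := by
  have join : ∀ {m} {z : (I.int (unary (m + 1))).Dom} {z₀ z₁},
      I.ref (unary m) (unary (m + 1)) z = some [z₀, z₁] → (∃ e, I.Unfolds m z₀ e) →
      (∃ e, I.Unfolds m z₁ e) → ∃ e, I.Unfolds (m + 1) z e := by
    rintro m z z₀ z₁ hz ⟨e₀, h₀⟩ ⟨e₁, h₁⟩
    refine ⟨fun j => if j < 2 ^ m then e₀ j else e₁ (j - 2 ^ m), z₀, z₁, hz,
      h₀.congr fun j hj => by simp [hj], h₁.congr fun j hj => by simp⟩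
  induction m with
  | zero => exact ⟨⟨fun _ => x, rfl⟩, ⟨fun _ => y, rfl⟩⟩
  | succ m ih =>
    obtain ⟨a₀, a₁, b₀, b₁, ha, hb, h₀, h₁, -⟩ := hr m hm x y hxy
    exact ⟨join ha (ih (by omega) h₀).1 (ih (by omega) h₁).1,
      join hb (ih (by omega) h₀).2 (ih (by omega) h₁).2⟩

variable {A : Name}

theorem AInterp.Unfolds.transport_both (hr : ∀ m < N, I.RowRefines m)
    (ht : ∀ m < N, I.Transports A true true m) {m : ℕ} (hm : m ≤ N)
    {x y : (I.int (unary m)).Dom} {e : ℕ → (I.int (unary 0)).Dom}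
    (hxy : (I.int (unary m)).role AbsDL.row x y) (hA : y ∈ (I.int (unary m)).concept A)
    (hy : I.Unfolds m y e) {j : ℕ} (hj : j < 2 ^ m) : e j ∈ (I.int (unary 0)).concept A := by
  induction m generalizing e j with
  | zero =>
    obtain rfl : j = 0 := by simpa using hj
    rw [show e 0 = y from hy]
    exact hA
  | succ m ih =>
    obtain ⟨a₀, a₁, b₀, b₁, -, hb, h₀, h₁, -⟩ := hr m hm x y hxy
    obtain ⟨c₀, c₁, hc, hA₀, hA₁⟩ := ht m hm x y hxy hA
    obtain ⟨d₀, d₁, hd, hd₀, hd₁⟩ := hy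
    obtain ⟨rfl, rfl⟩ : b₀ = d₀ ∧ b₁ = d₁ := by simpa [hb] using hd
    obtain ⟨rfl, rfl⟩ : b₀ = c₀ ∧ b₁ = c₁ := by simpa [hb] using hc
    by_cases hjm : j < 2 ^ m
    · exact ih (by omega) h₀ (hA₀ rfl) hd₀ hjm
    · have := ih (by omega) h₁ (hA₁ rfl) hd₁ (j := j - 2 ^ m) (by rw [pow_succ] at hj; omega)
      simpa only [Nat.sub_add_cancel (not_lt.1 hjm)] using this

theorem AInterp.Unfolds.transport_first (hr : ∀ m < N, I.RowRefines m)
    (ht : ∀ m < N, I.Transports A true false m) {m : ℕ} (hm : m ≤ N)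
    {x y : (I.int (unary m)).Dom} {e : ℕ → (I.int (unary 0)).Dom}
    (hxy : (I.int (unary m)).role AbsDL.row x y) (hA : y ∈ (I.int (unary m)).concept A)
    (hy : I.Unfolds m y e) : e 0 ∈ (I.int (unary 0)).concept A := by
  induction m generalizing e with
  | zero =>
    rw [show e 0 = y from hy]
    exact hA
  | succ m ih =>
    obtain ⟨a₀, a₁, b₀, b₁, -, hb, h₀, -, -⟩ := hr m hm x y hxy
    obtain ⟨c₀, c₁, hc, hA₀, -⟩ := ht m hm x y hxy hA
    obtain ⟨d₀, d₁, hd, hd₀, hd₁⟩ := hy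
    obtain ⟨rfl, rfl⟩ : b₀ = d₀ ∧ b₁ = d₁ := by simpa [hb] using hd
    obtain ⟨rfl, rfl⟩ : b₀ = c₀ ∧ b₁ = c₁ := by simpa [hb] using hc
    exact ih (by omega) h₀ (hA₀ rfl) hd₀

theorem AInterp.Unfolds.transport_last (hr : ∀ m < N, I.RowRefines m)
    (ht : ∀ m < N, I.Transports A false true m) {m : ℕ} (hm : m ≤ N)
    {x y : (I.int (unary m)).Dom} {e : ℕ → (I.int (unary 0)).Dom}
    (hxy : (I.int (unary m)).role AbsDL.row x y) (hA : y ∈ (I.int (unary m)).concept A)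
    (hy : I.Unfolds m y e) : e (2 ^ m - 1) ∈ (I.int (unary 0)).concept A := by
  induction m generalizing e with
  | zero =>
    have h1 : e 0 = y := hy
    simpa [h1] using hA
  | succ m ih =>
    obtain ⟨a₀, a₁, b₀, b₁, -, hb, -, h₁, -⟩ := hr m hm x y hxy
    obtain ⟨c₀, c₁, hc, -, hA₁⟩ := ht m hm x y hxy hA
    obtain ⟨d₀, d₁, hd, hd₀, hd₁⟩ := hy
    obtain ⟨rfl, rfl⟩ : b₀ = d₀ ∧ b₁ = d₁ := by simpa [hb] using hd
    obtain ⟨rfl, rfl⟩ : b₀ = c₀ ∧ b₁ = c₁ := by simpa [hb] using hc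
    have := ih (by omega) h₁ (hA₁ rfl) hd₁
    have hp : 0 < 2 ^ m := by positivity
    rwa [show 2 ^ m - 1 + 2 ^ m = 2 ^ (m + 1) - 1 by rw [pow_succ]; omega] at this

end Unfold

end AbsDL

namespace AbsDL

variable {Γ S : Type} [Finite Γ] [Finite S]

/-! ### Counters and cell contents in an arbitrary model -/

section Model

variable {A : Automaton Γ S} {F : Set S} {u : List Γ} {N : ℕ} {I : AInterp}

theorem bottom_of_isModel (hI : I.isModel (reduction A F u N).ontology) {C D : Concept}
    (h : (C, D) ∈ bottomInclusions Γ S) :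
    ∀ d ∈ (I.int (unary 0)).ext C, d ∈ (I.int (unary 0)).ext D := by
  refine (hI (inclusionAt 0 (C, D)) ?_).2
  simp only [reduction, layered, List.mem_append, List.mem_map]
  exact Or.inl ⟨_, h, rfl⟩

theorem rule_of_isModel (hI : I.isModel (reduction A F u N).ontology) {R : Rule}
    (h : R ∈ rules Γ S) {m : ℕ} (hm : m < N) : I.satisfies (R.toStatement m) := by
  refine hI _ ?_
  simp only [reduction, layered, List.mem_append, List.mem_flatMap, List.mem_map, List.mem_range]
  exact Or.inr (Or.inl ⟨m, hm, R, h, rfl⟩)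

theorem top_of_isModel (hI : I.isModel (reduction A F u N).ontology) {C D : Concept}
    (h : (C, D) ∈ topInclusions A) :
    ∀ d ∈ (I.int (unary N)).ext C, d ∈ (I.int (unary N)).ext D := by
  refine (hI (inclusionAt N (C, D)) ?_).2
  simp only [reduction, layered, List.mem_append, List.mem_map]
  exact Or.inr (Or.inr (Or.inl ⟨_, h, rfl⟩))

theorem input_of_isModel (hI : I.isModel (reduction A F u N).ontology) :
    ∀ d ∈ (I.int (unary N)).ext (nmC (Sig.start : Sig Γ S)),
      d ∈ (I.int (unary N)).ext (inputC S A.blank u) := by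
  refine (hI (inclusionAt N (nmC (Sig.start : Sig Γ S), inputC S A.blank u)) ?_).2
  simp only [reduction, layered, List.mem_append, List.mem_singleton]
  exact Or.inr (Or.inr (Or.inr trivial))

theorem mem_bottomInclusions {p : Concept × Concept} (c : Bool)
    (h : p ∈ counterInclusions Γ S c) : p ∈ bottomInclusions Γ S := by
  cases c <;> simp [bottomInclusions, h]

theorem rowRefines_of_isModel (hI : I.isModel (reduction A F u N).ontology) :
    ∀ m < N, I.RowRefines m := fun _ hm =>
  AInterp.rowRefines_of_satisfies (rule_of_isModel hI (by simp [rules]) hm)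

theorem chainRefines_of_isModel (hI : I.isModel (reduction A F u N).ontology) :
    ∀ m < N, I.ChainRefines m := fun _ hm =>
  AInterp.chainRefines_of_satisfies (rule_of_isModel hI (by simp [rules]) hm)

theorem transports_of_isModel (hI : I.isModel (reduction A F u N).ontology) {B : Name}
    {b₁ b₂ : Bool} (h : transportRule B b₁ b₂ ∈ rules Γ S) :
    ∀ m < N, I.Transports B b₁ b₂ m := fun _ hm =>
  AInterp.transports_of_satisfies (rule_of_isModel hI h hm)

variable (Γ S) in
/-- The objects of level `0` below the object `y` of level `N` store the counter values `v`. -/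
def Stores (I : AInterp) (N : ℕ) (y : (I.int (unary N)).Dom)
    (v : Bool → ZMod (2 ^ 2 ^ N)) : Prop :=
  ∃ e, I.Unfolds N y e ∧ ∀ c, ∀ j < 2 ^ N,
    (v c).val.testBit j = true ↔ e j ∈ (I.int (unary 0)).concept (nm (Sig.bit c : Sig Γ S))

/-- `y` is the successor of some object. -/
def IsSucc (I : AInterp) (N : ℕ) (y : (I.int (unary N)).Dom) : Prop :=
  ∃ x, (I.int (unary N)).role row x y

/-- Every bit pattern is a number modulo `2 ^ 2 ^ N`, so the values can be read off any unfolding.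
-/
theorem exists_stores (hI : I.isModel (reduction A F u N).ontology)
    {y : (I.int (unary N)).Dom} (hy : IsSucc I N y) : ∃ v, Stores Γ S I N y v := by
  obtain ⟨x, hx⟩ := hy
  obtain ⟨-, e, he⟩ := AInterp.exists_unfolds (rowRefines_of_isModel hI) le_rfl hx
  choose v hv using fun c => exists_val_testBit (M := 2 ^ N)
    fun j => e j ∈ (I.int (unary 0)).concept (nm (Sig.bit c : Sig Γ S))
  exact ⟨v, e, he, hv⟩

/-- The flag starts at the first bit, which is marked because every `row` successor on level `N` is
marked `first`, and it is passed on or refuted along each chain edge. -/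
theorem low_iff (hI : I.isModel (reduction A F u N).ontology)
    {y : (I.int (unary N)).Dom} (hy : IsSucc I N y) {e : ℕ → (I.int (unary 0)).Dom}
    (he : I.Unfolds N y e) (c : Bool) {j : ℕ} (hj : j < 2 ^ N) :
    e j ∈ (I.int (unary 0)).concept (nm (Sig.low c : Sig Γ S)) ↔
      ∀ k < j, e k ∉ (I.int (unary 0)).concept (nm (Sig.bit c : Sig Γ S)) := by
  obtain ⟨x, hx⟩ := hy
  have hr := rowRefines_of_isModel hI
  induction j with
  | zero =>
    have hf : y ∈ (I.int (unary N)).concept (nm (Sig.first : Sig Γ S)) :=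
      top_of_isModel hI (C := .top) (D := .all row (nmC (Sig.first : Sig Γ S)))
        (by simp [topInclusions]) x (Interp.mem_ext_top _) y hx
    have hf := he.transport_first hr (transports_of_isModel hI (by simp [rules])) le_rfl hx hf
    have := bottom_of_isModel hI (mem_bottomInclusions c
      (p := (nmC (Sig.first : Sig Γ S), nmC (Sig.low c : Sig Γ S)))
      (by simp [counterInclusions])) _ hf
    exact iff_of_true this (by simp)
  | succ j ih =>
    have hs := he.chain hr (chainRefines_of_isModel hI) le_rfl hx hj
    have ih := ih (by omega)
    by_cases h : e j ∈ (I.int (unary 0)).ext (lowZeroC Γ S c)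
    · have h1 := bottom_of_isModel hI (mem_bottomInclusions c
        (p := (lowZeroC Γ S c, .all chain (nmC (Sig.low c : Sig Γ S))))
        (by simp [counterInclusions])) _ h _ hs
      refine iff_of_true h1 fun k hk => ?_
      rcases Nat.lt_succ_iff_lt_or_eq.1 hk with hk | rfl
      · exact ih.1 h.1 k hk
      · exact h.2
    · have h1 := bottom_of_isModel hI (mem_bottomInclusions c
        (p := (.neg (lowZeroC Γ S c), .all chain (.neg (nmC (Sig.low c : Sig Γ S)))))
        (by simp [counterInclusions])) _ h _ hs
      refine iff_of_false h1 fun hk => h ⟨?_, hk j (by omega)⟩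
      exact ih.2 fun k hk' => hk k (by omega)

theorem eq_zero_of_stores (hI : I.isModel (reduction A F u N).ontology)
    {y : (I.int (unary N)).Dom} (hy : IsSucc I N y) {v : Bool → ZMod (2 ^ 2 ^ N)}
    (hv : Stores Γ S I N y v) (c : Bool)
    (hz : y ∈ (I.int (unary N)).concept (nm (Sig.zero c : Sig Γ S))) : v c = 0 := by
  obtain ⟨e, he, hv⟩ := hv
  obtain ⟨x, hx⟩ := hy
  refine eq_zero_of_val_testBit fun j hj => ?_
  have h1 := he.transport_both (rowRefines_of_isModel hI)
    (transports_of_isModel hI (by cases c <;> simp [rules])) le_rfl hx hz hj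
  have h2 := bottom_of_isModel hI (mem_bottomInclusions c
      (p := (nmC (Sig.zero c : Sig Γ S), .neg (nmC (Sig.bit c : Sig Γ S))))
      (by simp [counterInclusions])) _ h1
  rw [← Bool.not_eq_true]
  exact fun h3 => h2 ((hv c j hj).1 h3)

/-- It suffices to test the last bit: if the counter were zero, the last object would carry the flag
for zero lower bits while its own bit is zero, which `pos` forbids. -/
theorem ne_zero_of_stores (hI : I.isModel (reduction A F u N).ontology)
    {y : (I.int (unary N)).Dom} (hy : IsSucc I N y) {v : Bool → ZMod (2 ^ 2 ^ N)}
    (hv : Stores Γ S I N y v) (c : Bool)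
    (hz : y ∈ (I.int (unary N)).concept (nm (Sig.pos c : Sig Γ S))) : v c ≠ 0 := by
  obtain ⟨e, he, hv⟩ := hv
  obtain ⟨x, hx⟩ := hy
  have h1 := he.transport_last (rowRefines_of_isModel hI)
    (transports_of_isModel hI (by cases c <;> simp [rules])) le_rfl hx hz
  have h2 := bottom_of_isModel hI (mem_bottomInclusions c
      (p := (nmC (Sig.pos c : Sig Γ S),
        .union (.neg (nmC (Sig.low c : Sig Γ S))) (nmC (Sig.bit c : Sig Γ S))))
      (by simp [counterInclusions])) _ h1
  have hp : 2 ^ N - 1 < 2 ^ N := Nat.sub_lt (by positivity) one_pos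
  intro h0
  have hb : ∀ j < 2 ^ N, e j ∉ (I.int (unary 0)).concept (nm (Sig.bit c : Sig Γ S)) :=
    fun j hj => by rw [← hv c j hj]; simp [h0]
  rcases h2 with h2 | h2
  · exact h2 ((low_iff hI ⟨x, hx⟩ he c hp).2 fun k hk => hb k (hk.trans hp))
  · exact hb _ hp h2

/-- Edges between cells become edges between bits of equal index, along which the bottom inclusions
prescribe the new bit: for the counter `c` it is one exactly if the old bit and the flag for zero
lower bits disagree, and the other counter is copied. -/
theorem stores_succ (hI : I.isModel (reduction A F u N).ontology)
    {x y : (I.int (unary N)).Dom} (hx : IsSucc I N x) (hxy : (I.int (unary N)).role row x y)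
    {v : Bool → ZMod (2 ^ 2 ^ N)} (hv : Stores Γ S I N x v) (c : Bool)
    (hc : y ∈ (I.int (unary N)).concept (nm (Sig.dec c : Sig Γ S))) :
    Stores Γ S I N y (Function.update v c (v c - 1)) := by
  obtain ⟨w, e', he', hw⟩ := exists_stores hI ⟨x, hxy⟩
  obtain ⟨e, he, hv⟩ := hv
  have hr := rowRefines_of_isModel hI
  have key : ∀ j < 2 ^ N, (I.int (unary 0)).role row (e j) (e' j) :=
    fun j hj => AInterp.Unfolds.row hr le_rfl hxy he he' hj
  have hd : ∀ j < 2 ^ N, e' j ∈ (I.int (unary 0)).concept (nm (Sig.dec c : Sig Γ S)) :=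
    fun j hj => he'.transport_both hr
      (transports_of_isModel hI (by cases c <;> simp [rules])) le_rfl hxy hc hj
  -- The values `w` are read off the bits below `y`, so only equality of numbers remains, which is
  -- checked bit by bit.
  suffices w = Function.update v c (v c - 1) by
    rw [← this]
    exact ⟨e', he', hw⟩
  funext b
  refine eq_of_val_testBit fun j hj => ?_
  rw [hw b j hj]
  by_cases hbc : b = c
  · subst hbc
    rw [Function.update_self, testBit_val_sub_one _ hj]
    have hlow : (∀ k < j, (v b).val.testBit k = false) ↔
        e j ∈ (I.int (unary 0)).concept (nm (Sig.low b : Sig Γ S)) := by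
      rw [low_iff hI hx he b hj]
      refine forall₂_congr fun k hk => ?_
      rw [← hv b k (hk.trans hj), Bool.not_eq_true]
    rw [hlow, hv b j hj]
    by_cases hs : e j ∈ (I.int (unary 0)).ext (sameC Γ S b)
    · have h1 := bottom_of_isModel hI (mem_bottomInclusions b
        (p := (sameC Γ S b, .all row (.union (.neg (nmC (Sig.dec b : Sig Γ S)))
          (.neg (nmC (Sig.bit b : Sig Γ S)))))) (by simp [counterInclusions])) _ hs _ (key j hj)
      have h1 := h1.resolve_left fun h => h (hd j hj)
      refine iff_of_false h1 (not_not.2 ?_)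
      rcases hs with hs | hs
      · exact iff_of_true hs.1 hs.2
      · exact iff_of_false hs.1 hs.2
    · have h1 := bottom_of_isModel hI (mem_bottomInclusions b
        (p := (.neg (sameC Γ S b), .all row (.union (.neg (nmC (Sig.dec b : Sig Γ S)))
          (nmC (Sig.bit b : Sig Γ S))))) (by simp [counterInclusions])) _ hs _ (key j hj)
      have h1 := h1.resolve_left fun h => h (hd j hj)
      refine iff_of_true h1 fun h => hs ?_
      by_cases hbit : e j ∈ (I.int (unary 0)).concept (nm (Sig.bit b : Sig Γ S))
      · exact Or.inl ⟨hbit, h.1 hbit⟩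
      · exact Or.inr ⟨hbit, fun hl => hbit (h.2 hl)⟩
  · obtain rfl : c = !b := by cases b <;> cases c <;> simp_all
    rw [Function.update_of_ne hbc, hv b j hj]
    by_cases hbit : e j ∈ (I.int (unary 0)).concept (nm (Sig.bit b : Sig Γ S))
    · have h1 := bottom_of_isModel hI (mem_bottomInclusions b
        (p := (nmC (Sig.bit b : Sig Γ S), .all row (.union
          (.neg (nmC (Sig.dec (!b) : Sig Γ S))) (nmC (Sig.bit b : Sig Γ S)))))
        (by simp [counterInclusions])) _ hbit _ (key j hj)
      exact iff_of_true (h1.resolve_left fun h => h (hd j hj)) hbit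
    · have h1 := bottom_of_isModel hI (mem_bottomInclusions b
        (p := (.neg (nmC (Sig.bit b : Sig Γ S)), .all row (.union
          (.neg (nmC (Sig.dec (!b) : Sig Γ S))) (.neg (nmC (Sig.bit b : Sig Γ S))))))
        (by simp [counterInclusions])) _ hbit _ (key j hj)
      exact iff_of_false (h1.resolve_left fun h => h (hd j hj)) hbit

/-- While the position is decremented, the list loses its head and the tape symbol is kept, so the
entry looked up stays the same. At position zero the head is compared with the symbol; on the empty
list the symbol must be the blank. -/
theorem sym_eq_of_inputC (hI : I.isModel (reduction A F u N).ontology) {a : Γ} {l : List Γ}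
    {y : (I.int (unary N)).Dom} (hy : IsSucc I N y) {v : Bool → ZMod (2 ^ 2 ^ N)}
    (hv : Stores Γ S I N y v)
    (ha : y ∈ (I.int (unary N)).concept (nm (Sig.sym a : Sig Γ S)))
    (hl : y ∈ (I.int (unary N)).ext (inputC S A.blank l)) :
    a = l.getD (v true).val A.blank := by
  have uniq : ∀ {y b c}, y ∈ (I.int (unary N)).concept (nm (Sig.sym b : Sig Γ S)) →
      y ∈ (I.int (unary N)).concept (nm (Sig.sym c : Sig Γ S)) → b = c := by
    intro y b c hb hc
    by_contra hbc
    refine (Interp.mem_ext_bot _).1 (top_of_isModel hI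
      (C := (uniqueInclusion S (b, c)).1) (D := .bot) ?_ y ⟨hb, hc⟩)
    simp only [topInclusions, List.mem_cons, List.mem_append, List.mem_map, List.mem_filter]
    exact Or.inr (Or.inr (Or.inr ⟨(b, c), ⟨mem_elems _, by simpa using hbc⟩, rfl⟩))
  induction l generalizing y v with
  | nil => simpa using uniq ha hl
  | cons b l ih =>
    rcases hl with ⟨hz, hb⟩ | ⟨hp, z, hyz, hd, hw, hl⟩
    · rw [eq_zero_of_stores hI hy hv _ hz]
      simpa using uniq ha hb
    · have hne := ne_zero_of_stores hI hy hv _ hp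
      have hM : 1 < 2 ^ 2 ^ N := Nat.one_lt_two_pow (by positivity)
      have : Fact (1 < 2 ^ 2 ^ N) := ⟨hM⟩
      have hz := ih ⟨y, hyz⟩ (stores_succ hI hy hyz hv true hd) ?_ hl
      · rw [hz, Function.update_self]
        have h0 : (v true).val ≠ 0 := by rwa [Ne, ZMod.val_eq_zero]
        rw [ZMod.val_sub (by rw [ZMod.val_one]; omega), ZMod.val_one]
        obtain ⟨n, hn⟩ := Nat.exists_eq_succ_of_ne_zero h0
        simp [hn]
      · have := top_of_isModel hI (C := (walkInclusion S a).1) (D := (walkInclusion S a).2)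
          (by
            simp only [topInclusions, List.mem_cons, List.mem_append, List.mem_map]
            exact Or.inr (Or.inr (Or.inl ⟨a, mem_elems _, rfl⟩))) y ha z hyz
        exact this.resolve_left fun h => h hw

/-- Determinism makes up for the absence of any comparison between objects for the same cell:
whatever contents the predecessors claim, they are correct by induction. The bound on `t` ensures
that a positive time is not zero modulo `2 ^ 2 ^ N`, so the disjunct for the first row cannot be
used at a later time. -/
theorem cell_eq_conf (hI : I.isModel (reduction A F u N).ontology) {t : ℕ}
    (ht : t < 2 ^ 2 ^ N) {s : S} {y : (I.int (unary N)).Dom} (hy : IsSucc I N y)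
    {v : Bool → ZMod (2 ^ 2 ^ N)} (hv : Stores Γ S I N y v) (hvt : v false = t)
    (hs : y ∈ (I.int (unary N)).concept (nm (Sig.cell s : Sig Γ S))) :
    s = A.conf (2 ^ 2 ^ N) u t (v true) := by
  induction t generalizing y v s with
  | zero =>
    have := top_of_isModel hI (C := (cellInclusion A s).1) (D := (cellInclusion A s).2)
      (by
        simp only [topInclusions, List.mem_cons, List.mem_append, List.mem_map]
        exact Or.inr (Or.inl ⟨s, mem_elems _, rfl⟩)) y hs
    rcases this with ⟨-, hst, hin⟩ | ⟨hp, -⟩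
    · obtain ⟨C, hC, hin⟩ := (Interp.mem_ext_disj _).1 hin
      simp only [List.mem_map, List.mem_filter, decide_eq_true_eq] at hC
      obtain ⟨⟨b, a⟩, ⟨-, rfl⟩, rfl⟩ := hC
      obtain ⟨ha, hb⟩ := hin
      have h1 := sym_eq_of_inputC hI hy hv ha (input_of_isModel hI y hst)
      have h2 : b = decide (v true = 0) := by
        cases b with
        | true => simpa using eq_zero_of_stores hI hy hv _ hb
        | false => simpa using ne_zero_of_stores hI hy hv _ hb
      simp only [Automaton.conf]
      rw [← h1, ← h2]
    · exact absurd (by simpa using hvt) (ne_zero_of_stores hI hy hv _ hp)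
  | succ t ih =>
    have := top_of_isModel hI (C := (cellInclusion A s).1) (D := (cellInclusion A s).2)
      (by
        simp only [topInclusions, List.mem_cons, List.mem_append, List.mem_map]
        exact Or.inr (Or.inl ⟨s, mem_elems _, rfl⟩)) y hs
    rcases this with ⟨hz, -⟩ | ⟨-, hn⟩
    · have h0 := eq_zero_of_stores hI hy hv _ hz
      rw [hvt, ← ZMod.val_eq_zero, ZMod.val_natCast_of_lt ht] at h0
      omega
    · obtain ⟨C, hC, hn⟩ := (Interp.mem_ext_disj _).1 hn
      simp only [List.mem_map, List.mem_filter, decide_eq_true_eq] at hC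
      obtain ⟨⟨s₁, s₂, s₃⟩, ⟨-, rfl⟩, rfl⟩ := hC
      -- With `q` the position of `y`, the objects `y₃`, `y₂`, `y₁` stand for the positions `q`, `q
      -- - 1`, `q - 2` at time `t`.
      obtain ⟨y₃, h₃, d₃, c₃, y₂, h₂, d₂, c₂, y₁, h₁, d₁, c₁, -⟩ := hn
      have v₃ := stores_succ hI hy h₃ hv false d₃
      have v₂ := stores_succ hI ⟨_, h₃⟩ h₂ v₃ true d₂
      have v₁ := stores_succ hI ⟨_, h₂⟩ h₁ v₂ true d₁
      have e₃ := ih (by omega) ⟨_, h₃⟩ v₃ (by simp [hvt]) c₃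
      have e₂ := ih (by omega) ⟨_, h₂⟩ v₂ (by simp [hvt]) c₂
      have e₁ := ih (by omega) ⟨_, h₁⟩ v₁ (by simp [hvt]) c₁
      simp only [Function.update_self, ne_eq, Bool.true_eq_false, not_false_eq_true,
        Function.update_of_ne] at e₁ e₂ e₃
      simp only [Automaton.conf]
      rw [e₁, e₂, e₃]

theorem exists_conf_of_satisfiable (h : Satisfiable (reduction A F u N)) :
    ∃ t, ∃ q, A.conf (2 ^ 2 ^ N) u t q ∈ F := by
  obtain ⟨I, hI, -, x, y, hxy, hy⟩ := h
  obtain ⟨C, hC, hy⟩ := (Interp.mem_ext_disj _).1 hy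
  simp only [List.mem_map, List.mem_filter, decide_eq_true_eq] at hC
  obtain ⟨s, ⟨-, hs⟩, rfl⟩ := hC
  obtain ⟨v, hv⟩ := exists_stores (Γ := Γ) (S := S) hI ⟨x, hxy⟩
  refine ⟨(v false).val, v true, ?_⟩
  rw [← cell_eq_conf hI (ZMod.val_lt _) ⟨x, hxy⟩ hv (by simp) hy]
  exact hs

end Model

end AbsDL

namespace AbsDL

variable {Γ S : Type}

/-! ### From runs of the automaton to models -/

/-- The nodes of the model: the values of the two counters, the counter decremented along the
incoming edges, and the tape symbol that is looked up (if any). -/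
structure Node (Γ : Type) (M : ℕ) : Type where
  kind : Bool
  v : Bool → ZMod (2 ^ M)
  look : Option Γ

variable (A : Automaton Γ S) (u : List Γ)

/-- The tape symbol of a node. -/
def Node.letter {M : ℕ} (x : Node Γ M) : Γ :=
  x.look.getD (u.getD (x.v true).val A.blank)

/-- The node that is reached by decrementing the counter `c`. -/
def Node.next {M : ℕ} (x : Node Γ M) (c : Bool) (o : Option Γ) : Node Γ M :=
  ⟨c, Function.update x.v c (x.v c - 1), o⟩

/-- The edges between nodes. -/
def Node.Edge {M : ℕ} (x y : Node Γ M) : Prop :=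
  y.v = Function.update x.v y.kind (x.v y.kind - 1) ∧ ∀ a, y.look = some a → x.letter A u = a

/-- The extensions of the concept names on the level `i`. -/
def Node.Holds (N i : ℕ) (x : Node Γ (2 ^ N)) (j : ℕ) : Sig Γ S → Prop
  | .bit c => (x.v c).val.testBit j = true
  | .low c => ∀ k < j, (x.v c).val.testBit k = false
  | .dec c => x.kind = c
  | .zero c => x.v c = 0
  | .pos c => x.v c ≠ 0 ∧ j + 1 = 2 ^ (N - i)
  | .first => j = 0
  | .start => j = 0 ∧ x.look = none ∧ x.v false = 0
  | .walk => x.look ≠ none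
  | .sym a => x.letter A u = a
  | .cell s => j = 0 ∧ x.look = none ∧ s = A.conf (2 ^ 2 ^ N) u (x.v false).val (x.v true)

variable [Finite Γ] [Finite S]

/-- The interpretation on the level `i`. -/
noncomputable def levelInterp (N i : ℕ) : Interp where
  Dom := Node Γ (2 ^ N) × ℕ
  nonempty := ⟨⟨true, 0, none⟩, 0⟩
  concept B := {d | ∃ s : Sig Γ S, nm s = B ∧ d.1.Holds A u N i d.2 s}
  role r d e :=
    (r = row ∧ d.1.Edge A u e.1 ∧ e.2 = d.2 ∧ d.2 < 2 ^ (N - i)) ∨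
      (r = chain ∧ e.1 = d.1 ∧ e.2 = d.2 + 1 ∧ e.2 < 2 ^ (N - i))

variable (S) in
/-- The extension of a concept on the level `i`. -/
def levelExt (N i : ℕ) (C : Concept) : Set (Node Γ (2 ^ N) × ℕ) :=
  (levelInterp (S := S) A u N i).ext C

variable (S) in
/-- The extension of a role on the level `i`. -/
def levelRole (N i : ℕ) (r : Name) (d e : Node Γ (2 ^ N) × ℕ) : Prop :=
  (levelInterp (S := S) A u N i).role r d e

variable (S) in
/-- The truth of an atom on the level `i`. -/
def levelHolds (N i : ℕ) (g : Name → Node Γ (2 ^ N) × ℕ) (a : Atom) : Prop :=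
  (levelInterp (S := S) A u N i).holds g a

section

variable {A u} {N i : ℕ} {d e : Node Γ (2 ^ N) × ℕ}

theorem mem_levelExt_nmC {s : Sig Γ S} :
    d ∈ levelExt S A u N i (nmC s) ↔ d.1.Holds A u N i d.2 s := by
  constructor
  · rintro ⟨s', h, h'⟩
    rwa [← nm_injective h]
  · exact fun h => ⟨s, rfl, h⟩

theorem mem_levelExt_top : d ∈ levelExt S A u N i .top := Interp.mem_ext_top _

theorem mem_levelExt_neg {C : Concept} :
    d ∈ levelExt S A u N i (.neg C) ↔ d ∉ levelExt S A u N i C := Iff.rfl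

theorem mem_levelExt_inter {C D : Concept} : d ∈ levelExt S A u N i (.inter C D) ↔
    d ∈ levelExt S A u N i C ∧ d ∈ levelExt S A u N i D := Iff.rfl

theorem mem_levelExt_union {C D : Concept} : d ∈ levelExt S A u N i (.union C D) ↔
    d ∈ levelExt S A u N i C ∨ d ∈ levelExt S A u N i D := Iff.rfl

theorem mem_levelExt_disj {l : List Concept} : d ∈ levelExt S A u N i (.disj l) ↔
    ∃ C ∈ l, d ∈ levelExt S A u N i C := Interp.mem_ext_disj _

theorem levelHolds_role {g : Name → Node Γ (2 ^ N) × ℕ} {r x y : Name} :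
    levelHolds S A u N i g (.role r x y) ↔ levelRole S A u N i r (g x) (g y) := Iff.rfl

theorem levelHolds_concept {g : Name → Node Γ (2 ^ N) × ℕ} {C : Concept} {x : Name} :
    levelHolds S A u N i g (.concept C x) ↔ g x ∈ levelExt S A u N i C := Iff.rfl

theorem levelRole_row : levelRole S A u N i row d e ↔
    d.1.Edge A u e.1 ∧ e.2 = d.2 ∧ d.2 < 2 ^ (N - i) := by
  simp [levelRole, levelInterp, row, chain]

theorem levelRole_chain : levelRole S A u N i chain d e ↔
    e.1 = d.1 ∧ e.2 = d.2 + 1 ∧ e.2 < 2 ^ (N - i) := by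
  simp [levelRole, levelInterp, row, chain]

theorem mem_levelExt_ex_row {C : Concept} : d ∈ levelExt S A u N i (.ex row C) ↔
    ∃ e : Node Γ (2 ^ N) × ℕ, (d.1.Edge A u e.1 ∧ e.2 = d.2 ∧ d.2 < 2 ^ (N - i)) ∧
      e ∈ levelExt S A u N i C :=
  exists_congr fun _ => and_congr_left' levelRole_row

theorem mem_levelExt_all_row {C : Concept} : d ∈ levelExt S A u N i (.all row C) ↔
    ∀ e : Node Γ (2 ^ N) × ℕ, (d.1.Edge A u e.1 ∧ e.2 = d.2 ∧ d.2 < 2 ^ (N - i)) →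
      e ∈ levelExt S A u N i C :=
  forall_congr' fun _ => imp_congr_left levelRole_row

theorem mem_levelExt_all_chain {C : Concept} : d ∈ levelExt S A u N i (.all chain C) ↔
    ∀ e : Node Γ (2 ^ N) × ℕ, (e.1 = d.1 ∧ e.2 = d.2 + 1 ∧ e.2 < 2 ^ (N - i)) →
      e ∈ levelExt S A u N i C :=
  forall_congr' fun _ => imp_congr_left levelRole_chain

end

/-- The levels `0, …, N`, linearly ordered, form a tree. -/
theorem isDirectedTree_unary (N : ℕ) :
    IsDirectedTree {L | ∃ i ≤ N, L = unary i}
      (fun L' L => ∃ i < N, L = unary i ∧ L' = unary (i + 1)) := by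
  refine ⟨?_, unary N, ⟨N, le_rfl, rfl⟩, ?_, ?_, ?_⟩
  · rintro _ _ ⟨i, hi, rfl, rfl⟩
    exact ⟨⟨i + 1, hi, rfl⟩, ⟨i, hi.le, rfl⟩⟩
  · rintro x ⟨i, hi, h, -⟩
    exact hi.ne' (unary_injective h)
  · rintro _ ⟨i, hi, rfl⟩ hne
    refine ⟨unary (i + 1), ⟨i, lt_of_le_of_ne hi fun h => hne (by rw [h]), rfl, rfl⟩, ?_⟩
    rintro _ ⟨j, -, h, rfl⟩
    rw [unary_injective h]
  · rintro _ ⟨i, hi, rfl⟩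
    obtain ⟨k, rfl⟩ := Nat.exists_eq_add_of_le hi
    have : ∀ m ≤ k, Relation.ReflTransGen
        (fun L' L => ∃ j < i + k, L = unary j ∧ L' = unary (j + 1))
        (unary (i + k)) (unary (i + k - m)) := by
      intro m hm
      induction m with
      | zero => exact .refl
      | succ m ih =>
        exact (ih (by omega)).tail
          ⟨i + k - (m + 1), by omega, rfl, by rw [show i + k - (m + 1) + 1 = i + k - m by omega]⟩
    simpa using this k le_rfl

/-- The model for a run of the automaton. -/
noncomputable def runModel (N : ℕ) : AInterp where
  levels := {L | ∃ i ≤ N, L = unary i}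
  prec L L' := ∃ i < N, L = unary i ∧ L' = unary (i + 1)
  tree := isDirectedTree_unary N
  -- The number of a level is the length of its unary name.
  int L := levelInterp A u N L.length
  ref L L' d :=
    letI : Node Γ (2 ^ N) × ℕ := d
    @ite _ (∃ i < N, L = unary i ∧ L' = unary (i + 1)) (Classical.propDecidable _)
      (some [(d.1, 2 * d.2), (d.1, 2 * d.2 + 1)]) none
  ref_prec L L' d t h := by
    by_contra hn
    simp [hn] at h
  ref_nonempty L L' d t h := by
    rintro rfl
    split_ifs at h
    simp at h
  ref_unique := by
    rintro L ⟨x, j⟩ ⟨L₁, y₁, j₁⟩ ⟨L₂, y₂, j₂⟩ t₁ t₂ h₁ hm₁ h₂ hm₂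
    dsimp only at h₁ h₂
    split_ifs at h₁ with hL₁
    split_ifs at h₂ with hL₂
    obtain ⟨i₁, -, rfl, rfl⟩ := hL₁
    obtain ⟨i₂, -, h, rfl⟩ := hL₂
    obtain rfl := unary_injective h
    obtain rfl := Option.some.inj h₁
    obtain rfl := Option.some.inj h₂
    have hm₁ : (x, j) ∈ ([(y₁, 2 * j₁), (y₁, 2 * j₁ + 1)] : List (Node Γ (2 ^ N) × ℕ)) := hm₁
    have hm₂ : (x, j) ∈ ([(y₂, 2 * j₂), (y₂, 2 * j₂ + 1)] : List (Node Γ (2 ^ N) × ℕ)) := hm₂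
    simp only [List.mem_cons, Prod.mk.injEq, List.not_mem_nil, or_false] at hm₁ hm₂
    obtain ⟨rfl, rfl⟩ : y₁ = y₂ ∧ j₁ = j₂ := by
      constructor
      · rcases hm₁ with h | h <;> rcases hm₂ with h' | h' <;> exact h.1.symm.trans h'.1
      -- Both `j₁` and `j₂` are the integer part of `j / 2`.
      · omega
    rfl

theorem length_unary (n : ℕ) : (unary n).length = n := by simp [unary]

theorem runModel_int (N i : ℕ) : (runModel A u N).int (unary i) = levelInterp A u N i := by
  simp only [runModel, length_unary]

/-! ### Verification of the ontology in the model -/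

variable {A u}

theorem runModel_ref {N i : ℕ} (hi : i < N) (x : Node Γ (2 ^ N)) (j : ℕ) :
    (runModel (S := S) A u N).ref (unary i) (unary (i + 1)) (x, j) =
      some [(x, 2 * j), (x, 2 * j + 1)] := by
  have : ∃ k < N, unary i = unary k ∧ unary (i + 1) = unary (k + 1) := ⟨i, hi, rfl, rfl⟩
  simp only [runModel]
  exact if_pos this

theorem runModel_inclusionAt {N i : ℕ} (hi : i ≤ N) {p : Concept × Concept}
    (h : levelExt S A u N i p.1 ⊆ levelExt S A u N i p.2) :
    (runModel (S := S) A u N).satisfies (inclusionAt i p) := by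
  refine ⟨⟨i, hi, rfl⟩, ?_⟩
  rw [runModel_int]
  exact h

/-- A rule holds in the model if its atoms hold in the componentwise assignment. -/
theorem runModel_rule {N i : ℕ} (hi : i < N) {r : Name} {C : Concept} {l : List Atom} {hl}
    (h : ∀ (x y : Node Γ (2 ^ N)) (j k : ℕ),
      levelRole S A u N (i + 1) r (x, j) (y, k) →
      (y, k) ∈ levelExt S A u N (i + 1) C →
      ∀ g : Name → Node Γ (2 ^ N) × ℕ, g x₁ = (x, 2 * j) → g x₂ = (x, 2 * j + 1) →
        g y₁ = (y, 2 * k) → g y₂ = (y, 2 * k + 1) →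
        ∀ a ∈ l, levelHolds S A u N i g a) :
    (runModel (S := S) A u N).satisfies
      (Rule.toStatement ⟨pairCQ l hl, .top, r, C⟩ i) := by
  refine ⟨⟨i, hi, rfl, rfl⟩, ?_⟩
  rintro ⟨x, j⟩ ⟨y, k⟩ - hr hC
  refine ⟨_, _, ?_, runModel_ref hi x j, runModel_ref hi y k⟩
  have hr : levelRole S A u N (unary (i + 1)).length r (x, j) (y, k) := hr
  have hC : (y, k) ∈ levelExt S A u N (unary (i + 1)).length C := hC
  rw [length_unary] at hr hC
  have h' := h x y j k hr hC
  refine ⟨fun v => if v = x₁ then (x, 2 * j) else if v = x₂ then (x, 2 * j + 1) else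
    if v = y₁ then (y, 2 * k) else (y, 2 * k + 1), ?_, ?_, ?_⟩
  · change ∀ a ∈ l, levelHolds S A u N (unary i).length _ a
    rw [length_unary]
    exact h' _ (by simp) (by simp [x₁, x₂]) (by simp [x₁, x₂, y₁]) (by simp [x₁, x₂, y₁, y₂])
  · rfl
  · rfl

theorem runModel_rules {N i : ℕ} (hi : i < N) {R : Rule} (hR : R ∈ rules Γ S) :
    (runModel (S := S) A u N).satisfies (R.toStatement i) := by
  -- Each refinement doubles the number of relevant indices; in particular `2 * j + 1` is the last
  -- index on level `i` if `j` is the last one on level `i + 1`.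
  have hp : 2 ^ (N - i) = 2 * 2 ^ (N - (i + 1)) := by
    rw [← pow_succ']
    congr 1
    omega
  have transport : ∀ (s : Sig Γ S) (b₁ b₂ : Bool)
      (_h : ∀ (x : Node Γ (2 ^ N)) (j : ℕ), x.Holds A u N (i + 1) j s →
        (b₁ = true → x.Holds A u N i (2 * j) s) ∧ (b₂ = true → x.Holds A u N i (2 * j + 1) s)),
      (runModel (S := S) A u N).satisfies ((transportRule (nm s) b₁ b₂).toStatement i) := by
    intro s b₁ b₂ h
    refine runModel_rule hi ?_
    intro x y j k _ hC g _ _ h₁ h₂ a ha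
    have := h _ _ (mem_levelExt_nmC.1 hC)
    rcases List.mem_append.1 ha with ha | ha
    · cases b₁ <;> simp only [Bool.false_eq_true, if_true, if_false, List.mem_singleton,
        List.not_mem_nil] at ha
      subst ha
      refine levelHolds_concept.2 (mem_levelExt_nmC.2 ?_)
      rw [h₁]
      exact this.1 rfl
    · cases b₂ <;> simp only [Bool.false_eq_true, if_true, if_false, List.mem_singleton,
        List.not_mem_nil] at ha
      subst ha
      refine levelHolds_concept.2 (mem_levelExt_nmC.2 ?_)
      rw [h₂]
      exact this.2 rfl
  have hdec : ∀ c, (runModel (S := S) A u N).satisfies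
      ((transportRule (nm (Sig.dec c : Sig Γ S)) true true).toStatement i) := fun c =>
    transport _ _ _ fun x j h => ⟨fun _ => h, fun _ => h⟩
  have hzero : ∀ c, (runModel (S := S) A u N).satisfies
      ((transportRule (nm (Sig.zero c : Sig Γ S)) true true).toStatement i) := fun c =>
    transport _ _ _ fun x j h => ⟨fun _ => h, fun _ => h⟩
  have hpos : ∀ c, (runModel (S := S) A u N).satisfies
      ((transportRule (nm (Sig.pos c : Sig Γ S)) false true).toStatement i) := fun c =>
    transport _ _ _ fun x j h => ⟨by simp, fun _ => ⟨h.1, by rw [hp, ← h.2]; ring⟩⟩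
  simp only [rules, List.flatMap_cons, List.flatMap_nil, List.append_nil, List.cons_append,
    List.nil_append, List.mem_cons, List.not_mem_nil, or_false] at hR
  rcases hR with rfl | rfl | rfl | rfl | rfl | rfl | rfl | rfl | rfl
  · refine runModel_rule hi ?_
    intro x y j k hr _ g g₁ g₂ g₃ g₄
    simp only [List.mem_cons, List.not_mem_nil, or_false, forall_eq_or_imp, forall_eq,
      levelHolds_role, levelRole_row, levelRole_chain, g₁, g₂, g₃, g₄] at hr ⊢
    obtain ⟨hE, rfl, hk⟩ := hr
    exact ⟨⟨hE, rfl, by omega⟩, ⟨hE, rfl, by omega⟩, trivial, trivial, by omega⟩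
  · refine runModel_rule hi ?_
    intro x y j k hr _ g g₁ g₂ g₃ g₄
    simp only [List.mem_cons, List.not_mem_nil, or_false, forall_eq,
      levelHolds_role, levelRole_chain, g₂, g₃] at hr ⊢
    obtain ⟨rfl, rfl, hk⟩ := hr
    exact ⟨rfl, by ring, by omega⟩
  · refine transport _ _ _ fun x j h => ⟨fun _ => ?_, by simp⟩
    rw [show j = 0 from h]
    exact rfl
  · exact hdec _
  · exact hzero _
  · exact hpos _
  · exact hdec _
  · exact hzero _
  · exact hpos _

omit [Finite Γ] [Finite S] in
theorem Node.edge_next {M : ℕ} (x : Node Γ M) (c : Bool) {o : Option Γ}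
    (h : ∀ a, o = some a → x.letter A u = a) : x.Edge A u (x.next c o) :=
  ⟨rfl, h⟩

omit [Finite Γ] [Finite S] in
theorem Node.Edge.testBit {M : ℕ} {x y : Node Γ M} (h : x.Edge A u y) (c : Bool) {j : ℕ}
    (hj : j < M) : (y.v c).val.testBit j = true ↔
      if y.kind = c then
        ¬ ((x.v c).val.testBit j = true ↔ ∀ k < j, (x.v c).val.testBit k = false)
      else (x.v c).val.testBit j = true := by
  rw [h.1]
  split_ifs with hc
  · subst hc
    rw [Function.update_self]
    exact testBit_val_sub_one _ hj
  · rw [Function.update_of_ne (Ne.symm hc)]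

theorem runModel_bottom {N : ℕ} {p : Concept × Concept} (h : p ∈ bottomInclusions Γ S) :
    levelExt S A u N 0 p.1 ⊆ levelExt S A u N 0 p.2 := by
  obtain ⟨c, h⟩ : ∃ c, p ∈ counterInclusions Γ S c := by
    simp only [bottomInclusions, List.flatMap_cons, List.flatMap_nil, List.append_nil,
      List.mem_append] at h
    exact h.elim (fun h => ⟨_, h⟩) fun h => ⟨_, h⟩
  simp only [counterInclusions, List.mem_cons, List.not_mem_nil, or_false] at h
  rcases h with rfl | rfl | rfl | rfl | rfl | rfl | rfl | rfl | rfl <;> rintro ⟨x, j⟩ hx <;>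
    simp only [mem_levelExt_all_row, mem_levelExt_all_chain, mem_levelExt_union,
      mem_levelExt_neg, sameC, lowZeroC,
      mem_levelExt_inter, mem_levelExt_nmC, Node.Holds, Prod.forall] at hx ⊢
  · subst hx
    simp
  · rintro y k ⟨rfl, rfl, -⟩ i hi
    rcases Nat.lt_succ_iff_lt_or_eq.1 hi with hi | rfl
    · exact hx.1 i hi
    · simpa using hx.2
  · rintro y k ⟨rfl, rfl, -⟩ h
    exact hx ⟨fun i hi => h i (by omega), by simpa using h j (by omega)⟩
  · simp [hx]
  -- The concept `pos` holds only at the last bit on level `0`. If all lower bits and this bit were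
  -- zero, the whole counter would be zero.
  · by_contra! hn
    refine hx.1 (eq_zero_of_val_testBit fun i hi => ?_)
    rcases Nat.lt_or_ge i j with hij | hij
    · exact hn.1 i hij
    · obtain rfl : i = j := by
        have := hx.2
        simp only [Nat.sub_zero] at this
        omega
      simpa using hn.2
  · rintro y k ⟨hE, rfl, hk⟩
    have := hE.testBit c (by simpa using hk)
    by_cases hc : y.kind = c
    · rw [if_pos hc] at this
      refine Or.inr (this.2 fun h => hx ?_)
      by_cases hb : (x.v c).val.testBit k = true
      · exact Or.inl ⟨hb, h.1 hb⟩
      · exact Or.inr ⟨hb, fun hl => hb (h.2 hl)⟩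
    · exact Or.inl hc
  · rintro y k ⟨hE, rfl, hk⟩
    have := hE.testBit c (by simpa using hk)
    by_cases hc : y.kind = c
    · rw [if_pos hc] at this
      refine Or.inr fun h => this.1 h ?_
      rcases hx with hx | hx
      · exact iff_of_true hx.1 hx.2
      · exact iff_of_false hx.1 hx.2
    · exact Or.inl hc
  · rintro y k ⟨hE, rfl, hk⟩
    have := hE.testBit c (by simpa using hk)
    by_cases hc : y.kind = c
    · exact Or.inl (by simp [hc])
    · rw [if_neg hc] at this
      exact Or.inr (this.2 hx)
  · rintro y k ⟨hE, rfl, hk⟩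
    have := hE.testBit c (by simpa using hk)
    by_cases hc : y.kind = c
    · exact Or.inl (by simp [hc])
    · rw [if_neg hc] at this
      exact Or.inr fun h => hx (this.1 h)

/-- The witnesses are nodes whose component `look` stores the letter of `x`. It stays fixed while
the position decreases, although the input has other letters at the positions passed on the way. -/
theorem mem_ext_inputC {N : ℕ} (l : List Γ) (x : Node Γ (2 ^ N))
    (hx : x.letter A u = l.getD (x.v true).val A.blank) :
    (x, 0) ∈ levelExt S A u N N (inputC S A.blank l) := by
  induction l generalizing x with
  | nil =>
    refine mem_levelExt_nmC.2 ?_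
    simpa [Node.Holds] using hx
  | cons a l ih =>
    simp only [inputC, mem_levelExt_union, mem_levelExt_inter, mem_levelExt_ex_row,
      mem_levelExt_nmC]
    by_cases h0 : x.v true = 0
    · refine Or.inl ⟨h0, ?_⟩
      simpa [Node.Holds, h0] using hx
    · have hM : 1 < 2 ^ 2 ^ N := Nat.one_lt_two_pow (by positivity)
      have : Fact (1 < 2 ^ 2 ^ N) := ⟨hM⟩
      have h0' : (x.v true).val ≠ 0 := by rwa [Ne, ZMod.val_eq_zero]
      refine Or.inr ⟨⟨h0, by simp⟩, (x.next true (some (x.letter A u)), 0),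
        ⟨x.edge_next true (by simp), rfl, by simp⟩, rfl, by simp [Node.Holds, Node.next], ?_⟩
      refine ih _ ?_
      have h1 : (x.next true (some (x.letter A u))).letter A u = x.letter A u := rfl
      have h2 : (x.next true (some (x.letter A u))).v true = x.v true - 1 := by
        simp [Node.next]
      rw [h1, h2, hx, ZMod.val_sub (by rw [ZMod.val_one]; omega), ZMod.val_one]
      obtain ⟨n, hn⟩ := Nat.exists_eq_succ_of_ne_zero h0'
      simp [hn]

/-- The predecessors are reached by nodes that look up nothing, and such nodes carry the true
contents of the run. -/
theorem runModel_cell {N : ℕ} (s : S) :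
    levelExt S A u N N (cellInclusion A s).1 ⊆
      levelExt S A u N N (cellInclusion A s).2 := by
  rintro ⟨x, j⟩ hx
  obtain ⟨rfl, hl, rfl⟩ := mem_levelExt_nmC.1 hx
  simp only [cellInclusion, mem_levelExt_union, mem_levelExt_inter, mem_levelExt_nmC, initC, nextC,
    mem_levelExt_disj]
  by_cases h0 : x.v false = 0
  · refine Or.inl ⟨h0, ⟨rfl, hl, h0⟩, .inter (nmC (Sig.sym (x.letter A u) : Sig Γ S))
        (nmC (if decide (x.v true = 0) then Sig.zero true else Sig.pos true : Sig Γ S)), ?_, ?_⟩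
    · simp only [List.mem_map, List.mem_filter, decide_eq_true_eq]
      refine ⟨(decide (x.v true = 0), x.letter A u), ⟨mem_elems _, ?_⟩, by simp⟩
      simp [h0, Automaton.conf, Node.letter, show x.look = none from hl]
    · refine ⟨mem_levelExt_nmC.2 rfl, mem_levelExt_nmC.2 ?_⟩
      by_cases hq : x.v true = 0 <;> simp [hq, Node.Holds]
  · have hM : 1 < 2 ^ 2 ^ N := Nat.one_lt_two_pow (by positivity)
    have : Fact (1 < 2 ^ 2 ^ N) := ⟨hM⟩
    have h0' : (x.v false).val ≠ 0 := by rwa [Ne, ZMod.val_eq_zero]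
    have hv : (x.v false - 1).val = (x.v false).val - 1 := by
      rw [ZMod.val_sub (by rw [ZMod.val_one]; omega), ZMod.val_one]
    obtain ⟨n, hn⟩ := Nat.exists_eq_succ_of_ne_zero h0'
    rw [hn, Nat.succ_sub_one] at hv
    rw [hn]
    set f := A.conf (2 ^ 2 ^ N) u n with hf
    let p : S × S × S := (f (x.v true - 1 - 1), f (x.v true - 1), f (x.v true))
    refine Or.inr ⟨⟨h0, by simp⟩,
      succC Γ false p.2.2 (succC Γ true p.2.1 (succC Γ true p.1 .top)), ?_, ?_⟩
    · simp only [List.mem_map, List.mem_filter, decide_eq_true_eq]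
      exact ⟨p, ⟨mem_elems _, rfl⟩, rfl⟩
    · have step : ∀ (y : Node Γ (2 ^ N)) (c : Bool) (s : S) (C : Concept),
          (y.next c none).Holds A u N N 0 (Sig.cell s) →
          (y.next c none, 0) ∈ levelExt S A u N N C →
          (y, 0) ∈ levelExt S A u N N (succC Γ c s C) := by
        intro y c s C hs hC
        refine ⟨(y.next c none, 0), levelRole_row.2 ⟨y.edge_next c (by simp), rfl, by simp⟩,
          mem_levelExt_nmC.2 rfl, mem_levelExt_nmC.2 hs, hC⟩
      refine step _ _ _ _ ⟨rfl, rfl, ?_⟩ (step _ _ _ _ ⟨rfl, rfl, ?_⟩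
        (step _ _ _ _ ⟨rfl, rfl, ?_⟩ mem_levelExt_top)) <;>
        simp [p, Node.next, hv, hf]

theorem runModel_top {N : ℕ} {p : Concept × Concept} (h : p ∈ topInclusions A) :
    levelExt S A u N N p.1 ⊆ levelExt S A u N N p.2 := by
  simp only [topInclusions, List.mem_cons, List.mem_append, List.mem_map, List.mem_filter,
    decide_eq_true_eq] at h
  rcases h with rfl | ⟨s, -, rfl⟩ | ⟨a, -, rfl⟩ | ⟨⟨a, b⟩, ⟨-, hab⟩, rfl⟩
  · rintro ⟨x, j⟩ - ⟨y, k⟩ hr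
    obtain ⟨-, rfl, hk⟩ := levelRole_row.1 hr
    refine mem_levelExt_nmC.2 ?_
    simpa [Node.Holds] using hk
  · exact runModel_cell s
  · rintro ⟨x, j⟩ hx ⟨y, k⟩ hr
    obtain ⟨hE, rfl, hk⟩ := levelRole_row.1 hr
    have hx := mem_levelExt_nmC.1 hx
    change (y, k) ∈ levelExt S A u N N _
    simp only [mem_levelExt_union, mem_levelExt_neg, mem_levelExt_nmC, Node.Holds, not_not]
    cases ho : y.look with
    | none => exact Or.inl rfl
    | some b =>
      refine Or.inr ?_
      have h1 := hE.2 b ho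
      have h2 : x.letter A u = a := hx
      simp [Node.letter, ho, ← h1, ← h2]
  · rintro ⟨x, j⟩ ⟨ha, hb⟩
    have ha : x.letter A u = a := mem_levelExt_nmC.1 ha
    have hb : x.letter A u = b := mem_levelExt_nmC.1 hb
    exact absurd (ha.symm.trans hb) hab

theorem satisfiable_of_conf {F : Set S} {N t : ℕ} (ht : t < 2 ^ 2 ^ N) {q : ZMod (2 ^ 2 ^ N)}
    (h : A.conf (2 ^ 2 ^ N) u t q ∈ F) : Satisfiable (reduction A F u N) := by
  refine ⟨runModel (S := S) A u N, ?_, ⟨N, le_rfl, rfl⟩, ?_⟩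
  · intro s hs
    simp only [reduction, layered, List.mem_append, List.mem_map, List.mem_flatMap,
      List.mem_range, List.mem_singleton] at hs
    rcases hs with ⟨p, hp, rfl⟩ | ⟨i, hi, R, hR, rfl⟩ | ⟨p, hp, rfl⟩ | rfl
    · exact runModel_inclusionAt (Nat.zero_le _) (runModel_bottom hp)
    · exact runModel_rules hi hR
    · exact runModel_inclusionAt le_rfl (runModel_top hp)
    · refine runModel_inclusionAt le_rfl ?_
      rintro ⟨x, j⟩ hx
      obtain ⟨rfl, hl, -⟩ := mem_levelExt_nmC.1 hx
      have hl : x.look = none := hl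
      exact mem_ext_inputC u x (by simp [Node.letter, hl])
  · change (((runModel (S := S) A u N).int (unary N)).ext (queryC Γ F)).Nonempty
    rw [runModel_int]
    -- The queried cell has to be a `row` successor, since counters are enforced only for
    -- successors. Decrementing the time `t + 1` leads to the cell `(t, q)`.
    let x : Node Γ (2 ^ N) := ⟨false, fun c => if c then q else t + 1, none⟩
    refine ⟨(x, 0), (x.next false none, 0),
      levelRole_row.2 ⟨x.edge_next false (by simp), rfl, by simp⟩, ?_⟩
    refine mem_levelExt_disj.2 ⟨nmC (Sig.cell (A.conf (2 ^ 2 ^ N) u t q) : Sig Γ S), ?_, ?_⟩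
    · simp only [List.mem_map, List.mem_filter, decide_eq_true_eq]
      exact ⟨_, ⟨mem_elems _, h⟩, rfl⟩
    · refine mem_levelExt_nmC.2 ⟨rfl, rfl, ?_⟩
      simp [x, Node.next, ZMod.val_natCast_of_lt ht]

/-- A model reveals a content in `F` at an unspecified time; the hypothesis `h` moves it to the time
`T`. -/
theorem satisfiable_reduction_iff {F : Set S} {N T : ℕ} (hT : T < 2 ^ 2 ^ N)
    (h : ∀ t q, A.conf (2 ^ 2 ^ N) u t q ∈ F → ∃ q, A.conf (2 ^ 2 ^ N) u T q ∈ F) :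
    Satisfiable (reduction A F u N) ↔ ∃ q, A.conf (2 ^ 2 ^ N) u T q ∈ F := by
  constructor
  · intro hs
    obtain ⟨t, q, htq⟩ := exists_conf_of_satisfiable hs
    exact h t q htq
  · rintro ⟨q, hq⟩
    exact satisfiable_of_conf hT hq

end AbsDL

namespace AbsDL

/-! ### Turing machines as cellular automata -/

section Machine

open Turing

variable {Γ Λ : Type} [Inhabited Γ] [Inhabited Λ]

/-- The state in which the head enters a neighbouring cell when it leaves a cell with content `c`
in direction `d`. -/
def arrive (M : TM0.Machine Γ Λ) (d : Dir) (c : Γ × Option Λ) : Option Λ :=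
  c.2.bind fun q => (M q c.1).bind fun p =>
    match p.2 with
    | .move d' => if d' = d then some p.1 else none
    | .write _ => none

/-- The content of a cell after one step, depending on its content and on its two neighbours. -/
def cellNext (M : TM0.Machine Γ Λ) (l m r : Γ × Option Λ) : Γ × Option Λ :=
  match m.2 with
  | none => (m.1, (arrive M .right l).or (arrive M .left r))
  | some q =>
    match M q m.1 with
    | none => (m.1, some q)
    | some (q', .write b) => (b, some q')
    | some (_, .move _) => (m.1, none)

/-- The automaton that simulates a Turing machine. -/
def machineAutomaton (M : TM0.Machine Γ Λ) : Automaton Γ (Γ × Option Λ) where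
  blank := default
  init b a := (a, if b then some default else none)
  next := cellNext M

/-- One step of the machine; halted machines stay as they are. -/
def stay (M : TM0.Machine Γ Λ) (c : TM0.Cfg Γ Λ) : TM0.Cfg Γ Λ :=
  (TM0.step M c).getD c

theorem stay_iterate_of_bind_iterate {M : TM0.Machine Γ Λ} {k : ℕ} {c d : TM0.Cfg Γ Λ}
    (h : (fun s : Option (TM0.Cfg Γ Λ) => s.bind (TM0.step M))^[k] (some c) = some d) :
    (stay M)^[k] c = d := by
  induction k generalizing d with
  | zero => simpa using h
  | succ k ih =>
    rw [Function.iterate_succ_apply'] at h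
    obtain ⟨e, he, hd⟩ := Option.bind_eq_some_iff.1 h
    rw [Function.iterate_succ_apply', ih he, stay, hd]
    rfl

/-- The row `f` of the automaton, shifted by `t`, represents the configuration `c` with the head at
position `h`, as far as positions of absolute value at most `B` are concerned. -/
structure Represents (K B : ℕ) (t : ℕ) (f : ZMod K → Γ × Option Λ) (c : TM0.Cfg Γ Λ) (h : ℤ) :
    Prop where
  tape : ∀ z : ℤ, |z| ≤ B → (f ((z : ZMod K) + t)).1 = c.Tape.nth (z - h)
  head : ∀ q : ZMod K, (f q).2 = if q = (h : ZMod K) + t then some c.q else none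

/-- The difference is divisible by `K` and has absolute value at most `2 * B`. -/
theorem intCast_injOn {K B : ℕ} (hK : 2 * B < K) {y z : ℤ} (hy : |y| ≤ B) (hz : |z| ≤ B)
    (h : (y : ZMod K) = z) : y = z := by
  rw [ZMod.intCast_eq_intCast_iff_dvd_sub] at h
  have h0 := Int.eq_zero_of_abs_lt_dvd h (by
    rw [abs_lt]
    rw [abs_le] at hy hz
    constructor <;> omega)
  omega

/-- Since the row at time `t` is shifted by `t`, the new cell `q` continues the old cell `q - 1`,
whose neighbours are `q - 2` and `q`. Only the cell of the head and the cell that it enters need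
attention. The head is described on the whole cycle, so no spurious second head can arise outside
the window in which the tape is known. -/
theorem Represents.next {M : TM0.Machine Γ Λ} {K B t : ℕ} (hB : 1 ≤ B) (hK : 2 * B < K)
    {f g : ZMod K → Γ × Option Λ} {c : TM0.Cfg Γ Λ} {h : ℤ} (hr : Represents K B t f c h)
    (hh : |h| ≤ B) (hg : ∀ q, g q = cellNext M (f (q - 1 - 1)) (f (q - 1)) (f q)) :
    ∃ h', Represents K B (t + 1) g (stay M c) h' ∧ |h'| ≤ |h| + 1 ∧
      (TM0.step M c = none → h' = h) := by
  have : Fact (1 < K) := ⟨by omega⟩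
  obtain ⟨q₀, T⟩ := c
  have hread : (f (h + t)).1 = T.1 := by
    rw [hr.tape h hh, sub_self, Tape.nth_zero]
  have hhead : f (h + t) = (T.1, some q₀) := Prod.ext hread (by rw [hr.head, if_pos rfl])
  have hne : ∀ q, q ≠ (h : ZMod K) + t → (f q).2 = none := fun q hq => by
    rw [hr.head, if_neg hq]
  have harr : ∀ d q, arrive M d (f q) =
      if q = (h : ZMod K) + t then arrive M d (T.1, some q₀) else none := by
    intro d q
    split_ifs with hq
    · rw [hq, hhead]
    · simp [arrive, hne q hq]
  have hmid : ∀ q, q - 1 ≠ (h : ZMod K) + t → g q = ((f (q - 1)).1,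
      (arrive M .right (f (q - 1 - 1))).or (arrive M .left (f q))) := by
    intro q hq
    rw [hg, cellNext, hne _ hq]
  have hmid' : ∀ q, q - 1 = (h : ZMod K) + t →
      g q = cellNext M (f (q - 1 - 1)) (T.1, some q₀) (f q) := by
    intro q hq
    rw [hg, hq, hhead]
  have hz : ∀ z : ℤ, |z| ≤ B → (z : ZMod K) + (t + 1 : ℕ) - 1 = h + t → z = h := by
    intro z hz he
    refine intCast_injOn hK hz hh ?_
    have : (z : ZMod K) + t = h + t := by
      rw [← he]
      push_cast
      ring
    exact add_right_cancel this
  have hsub : ∀ z : ℤ, (z : ZMod K) + (t + 1 : ℕ) - 1 = z + t := fun z => by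
    push_cast
    ring
  -- the head position of the next configuration in terms of the old row
  have hpos : ∀ q : ZMod K, ∀ i : ℤ,
      q = ((h + i : ℤ) : ZMod K) + (t + 1 : ℕ) ↔ q - 1 = h + t + i := by
    intro q i
    rw [sub_eq_iff_eq_add]
    push_cast
    ring_nf
  cases hM : M q₀ T.1 with
  | none =>
    have hstay : stay M ⟨q₀, T⟩ = ⟨q₀, T⟩ := by simp [stay, TM0.step, hM]
    have ha : ∀ d, arrive M d (T.1, some q₀) = none := fun d => by simp [arrive, hM]
    rw [hstay]
    refine ⟨h, ⟨fun z hzB => ?_, fun q => ?_⟩, by omega, fun _ => rfl⟩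
    · by_cases he : (z : ZMod K) + (t + 1 : ℕ) - 1 = h + t
      · rw [hmid' _ he, hz z hzB he]
        simp [cellNext, hM]
      · rw [hmid _ he, hsub]
        exact hr.tape z hzB
    · have h0 := hpos q 0
      simp only [add_zero, Int.cast_zero] at h0
      simp only [h0]
      split_ifs with he
      · rw [hmid' _ he]
        simp [cellNext, hM]
      · rw [hmid _ he, harr, harr, ha, ha]
        simp
  | some p =>
    obtain ⟨q₁, s⟩ := p
    cases s with
    | write b =>
      have hstay : stay M ⟨q₀, T⟩ = ⟨q₁, T.write b⟩ := by simp [stay, TM0.step, hM]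
      have ha : ∀ d, arrive M d (T.1, some q₀) = none := fun d => by simp [arrive, hM]
      rw [hstay]
      refine ⟨h, ⟨fun z hzB => ?_, fun q => ?_⟩, by omega, fun _ => rfl⟩
      · rw [Tape.write_nth]
        by_cases he : (z : ZMod K) + (t + 1 : ℕ) - 1 = h + t
        · rw [hmid' _ he, hz z hzB he]
          simp [cellNext, hM]
        · rw [hmid _ he, hsub, if_neg]
          · exact hr.tape z hzB
          · intro hzh
            rw [sub_eq_zero.1 hzh, hsub] at he
            exact he rfl
      · have h0 := hpos q 0
        simp only [add_zero, Int.cast_zero] at h0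
        simp only [h0]
        split_ifs with he
        · rw [hmid' _ he]
          simp [cellNext, hM]
        · rw [hmid _ he, harr, harr, ha, ha]
          simp
    | move d =>
      have hstay : stay M ⟨q₀, T⟩ = ⟨q₁, T.move d⟩ := by simp [stay, TM0.step, hM]
      have ha : ∀ d', arrive M d' (T.1, some q₀) = if d = d' then some q₁ else none :=
        fun d' => by simp [arrive, hM]
      have htape : ∀ z : ℤ, |z| ≤ B → (g ((z : ZMod K) + (t + 1 : ℕ))).1 = T.nth (z - h) := by
        intro z hzB
        by_cases he : (z : ZMod K) + (t + 1 : ℕ) - 1 = h + t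
        · rw [hmid' _ he, hz z hzB he]
          simp [cellNext, hM]
        · rw [hmid _ he, hsub]
          exact hr.tape z hzB
      rw [hstay]
      cases d with
      | right =>
        refine ⟨h + 1, ⟨fun z hzB => ?_, fun q => ?_⟩, abs_add_le h 1, fun hs => ?_⟩
        · rw [htape z hzB, Tape.move_right_nth]
          congr 1
          ring
        · simp only [hpos]
          by_cases he : q - 1 = h + t
          · rw [hmid' _ he, he, if_neg (by simp)]
            simp [cellNext, hM]
          · rw [hmid _ he, harr, harr, ha, ha]
            have : q - 1 - 1 = h + t ↔ q - 1 = h + t + (1 : ℤ) := by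
              rw [sub_eq_iff_eq_add]
              simp
            simp [this]
        · simp [TM0.step, hM] at hs
      | left =>
        refine ⟨h + -1, ⟨fun z hzB => ?_, fun q => ?_⟩, by simpa using abs_add_le h (-1),
          fun hs => ?_⟩
        · rw [htape z hzB, Tape.move_left_nth]
          congr 1
          ring
        · simp only [hpos]
          by_cases he : q - 1 = h + t
          · rw [hmid' _ he, he, if_neg (by simp)]
            simp [cellNext, hM]
          · rw [hmid _ he, harr, harr, ha, ha]
            have : q = h + t ↔ q - 1 = h + t + (-1 : ℤ) := by
              rw [sub_eq_iff_eq_add]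
              simp
            simp only [← this]
            simp
        · simp [TM0.step, hM] at hs

theorem represents_init (M : TM0.Machine Γ Λ) {K B : ℕ} (hK : 2 * B < K) {u : List Γ}
    (hu : u.length ≤ B) :
    Represents K B 0 ((machineAutomaton M).conf K u 0) (TM0.init u) 0 := by
  have : NeZero K := ⟨by omega⟩
  refine ⟨fun z hz => ?_, fun q => ?_⟩
  · simp only [Automaton.conf, machineAutomaton, TM0.init, Tape.mk₁, Tape.mk₂, Nat.cast_zero,
      add_zero, sub_zero]
    rcases Int.eq_nat_or_neg z with ⟨n, rfl | rfl⟩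
    · have hn : n ≤ B := by simpa using hz
      rw [Tape.mk'_nth_nat, ListBlank.nth_mk, Int.cast_natCast,
        ZMod.val_natCast_of_lt (by omega), List.getI_eq_getElem?_getD, List.getD_eq_getElem?_getD]
    · have hn : n ≤ B := by simpa using hz
      cases n with
      | zero =>
        have := Tape.mk'_nth_nat (ListBlank.mk ([] : List Γ)) (ListBlank.mk u) 0
        simp only [Nat.cast_zero] at this
        simp only [Nat.cast_zero, neg_zero, Int.cast_zero, ZMod.val_zero]
        rw [this, ListBlank.nth_mk, List.getI_eq_getElem?_getD, List.getD_eq_getElem?_getD]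
      | succ n =>
        have h1 : (Tape.mk' (ListBlank.mk ([] : List Γ)) (ListBlank.mk u)).nth (-((n + 1 : ℕ) : ℤ))
            = default := by
          change (ListBlank.mk ([] : List Γ)).nth n = default
          rw [ListBlank.nth_mk]
          simp [List.getI]
        rw [h1, List.getD_eq_default]
        -- Cells to the left of the input are the last ones of the cycle. Their index is at least `K
        -- - B > B`, hence beyond the input, so they are blank.
        have hcast : ((-((n + 1 : ℕ) : ℤ) : ℤ) : ZMod K) = ((K - (n + 1) : ℕ) : ZMod K) := by
          rw [Nat.cast_sub (by omega)]
          simp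
        rw [hcast, ZMod.val_natCast_of_lt (by omega)]
        omega
  · simp [Automaton.conf, machineAutomaton, TM0.init]

/-- The contents of the cell of the head in a halted configuration with state in `acc`. -/
def haltedIn (M : TM0.Machine Γ Λ) (acc : Set Λ) : Set (Γ × Option Λ) :=
  {p | ∃ q ∈ acc, p.2 = some q ∧ M q p.1 = none}

theorem step_eq_none_iff {M : TM0.Machine Γ Λ} {c : TM0.Cfg Γ Λ} :
    TM0.step M c = none ↔ M c.q c.Tape.1 = none := by
  obtain ⟨q, T⟩ := c
  simp [TM0.step]

theorem stay_iterate_of_halted {M : TM0.Machine Γ Λ} {c : TM0.Cfg Γ Λ}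
    (h : TM0.step M c = none) (n : ℕ) : (stay M)^[n] c = c :=
  Function.iterate_fixed (by simp [stay, h]) n

/-- The head moves by at most one cell in each step and stops moving once the machine has halted.
Thus it remains within distance `k` at all times, even at times beyond `B` or `K`. -/
theorem exists_represents (M : TM0.Machine Γ Λ) {K B : ℕ} (hB : 1 ≤ B) (hK : 2 * B < K)
    {u : List Γ} (hu : u.length ≤ B) {k : ℕ} (hk : k ≤ B)
    (hhalt : TM0.step M ((stay M)^[k] (TM0.init u)) = none) (t : ℕ) :
    ∃ h : ℤ, (|h| ≤ t ∧ |h| ≤ k) ∧ Represents K B t ((machineAutomaton M).conf K u t)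
      ((stay M)^[t] (TM0.init u)) h := by
  induction t with
  | zero => exact ⟨0, by simp, represents_init M hK hu⟩
  | succ t ih =>
    obtain ⟨h, hh, hr⟩ := ih
    obtain ⟨h', hr', hh', hfix⟩ := hr.next (M := M) hB hK (by omega)
      (g := (machineAutomaton M).conf K u (t + 1)) fun q => rfl
    rw [Function.iterate_succ_apply']
    refine ⟨h', ?_, hr'⟩
    rcases lt_or_ge t k with htk | htk
    · push_cast
      omega
    · obtain ⟨n, rfl⟩ := Nat.exists_eq_add_of_le htk
      rw [hfix, Nat.cast_add_one]
      · omega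
      · rwa [add_comm, Function.iterate_add_apply, stay_iterate_of_halted hhalt]

/-- The automaton reaches a content in `haltedIn M acc` if and only if the machine halts in a
state of the set `acc`. -/
theorem conf_mem_haltedIn_iff (M : TM0.Machine Γ Λ) (acc : Set Λ) {K B : ℕ} (hB : 1 ≤ B)
    (hK : 2 * B < K) {u : List Γ} (hu : u.length ≤ B) {k : ℕ} (hk : k ≤ B) {c : TM0.Cfg Γ Λ}
    (hc : (stay M)^[k] (TM0.init u) = c) (hhalt : TM0.step M c = none) :
    (∀ t q, (machineAutomaton M).conf K u t q ∈ haltedIn M acc → c.q ∈ acc) ∧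
      (c.q ∈ acc → ∃ q, (machineAutomaton M).conf K u k q ∈ haltedIn M acc) := by
  have hex := exists_represents M hB hK hu hk (by rwa [hc])
  have content : ∀ t, ∀ h : ℤ, |h| ≤ k →
      Represents K B t ((machineAutomaton M).conf K u t) ((stay M)^[t] (TM0.init u)) h →
      (machineAutomaton M).conf K u t (h + t) = (((stay M)^[t] (TM0.init u)).Tape.1,
        some ((stay M)^[t] (TM0.init u)).q) := by
    intro t h hh hr
    refine Prod.ext ?_ ?_
    · rw [hr.tape h (by omega), sub_self, Tape.nth_zero]
    · rw [hr.head, if_pos rfl]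
  constructor
  · rintro t q ⟨s, hs, h₁, h₂⟩
    obtain ⟨h, ⟨-, hh⟩, hr⟩ := hex t
    have hq : q = h + t := by
      by_contra hq
      rw [hr.head, if_neg hq] at h₁
      cases h₁
    rw [hq, content t h hh hr] at h₁ h₂
    obtain rfl : _ = s := Option.some.inj h₁
    have hhalt' := step_eq_none_iff.2 h₂
    have : (stay M)^[t] (TM0.init u) = c := by
      rcases le_total t k with htk | htk
      · obtain ⟨n, rfl⟩ := Nat.exists_eq_add_of_le htk
        rw [← hc, add_comm, Function.iterate_add_apply, stay_iterate_of_halted hhalt']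
      · obtain ⟨n, rfl⟩ := Nat.exists_eq_add_of_le htk
        rw [add_comm, Function.iterate_add_apply, hc, stay_iterate_of_halted hhalt]
    rwa [← this]
  · intro hacc
    obtain ⟨h, ⟨-, hh⟩, hr⟩ := hex k
    refine ⟨h + k, c.q, hacc, ?_⟩
    rw [content k h hh hr, hc]
    exact ⟨rfl, step_eq_none_iff.1 hhalt⟩

/-- The reduction is correct if the number of levels is large enough. -/
theorem satisfiable_machineAutomaton_iff [Finite Γ] [Finite Λ] (M : TM0.Machine Γ Λ)
    (acc : Set Λ) {N B : ℕ} (hB : 1 ≤ B) (hN : 2 * B < 2 ^ 2 ^ N) {u : List Γ}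
    (hu : u.length ≤ B) {k : ℕ} (hk : k ≤ B) {c : TM0.Cfg Γ Λ}
    (hc : (fun s : Option (TM0.Cfg Γ Λ) => s.bind (TM0.step M))^[k] (some (TM0.init u)) = some c)
    (hhalt : TM0.step M c = none) :
    Satisfiable (reduction (machineAutomaton M) (haltedIn M acc) u N) ↔ c.q ∈ acc := by
  obtain ⟨h₁, h₂⟩ := conf_mem_haltedIn_iff M acc hB hN hu hk (stay_iterate_of_bind_iterate hc)
    hhalt
  rw [satisfiable_reduction_iff (T := k) (by omega) fun t q h => h₂ (h₁ t q h)]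
  exact ⟨fun ⟨q, hq⟩ => h₁ k q hq, h₂⟩

end Machine

end AbsDL

/-! ### Structured programs for stack machines -/

namespace StackProgram

open Turing

variable {K : Type} (Γ : K → Type)

/-- Programs that push symbols and run loops in which a stack is emptied. -/
inductive Cmd : Type
  | skip
  | push (k : K) (x : Γ k)
  | seq (c d : Cmd)
  | loop (k : K) (body : Γ k → Cmd)

/-- The contents of the stacks. -/
abbrev Store : Type := ∀ k, List (Γ k)

variable {Γ}

/-- The labels of the machine for a program. -/
def Cmd.Label : Cmd Γ → Type
  | .skip => Unit
  | .push _ _ => Unit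
  | .seq c d => c.Label ⊕ d.Label
  | .loop k body => Option ((x : Γ k) × (body x).Label)

theorem Cmd.finite_label [∀ k, Finite (Γ k)] (c : Cmd Γ) : Finite c.Label := by
  induction c with
  | skip => exact inferInstanceAs (Finite Unit)
  | push k x => exact inferInstanceAs (Finite Unit)
  | seq c d ihc ihd => exact inferInstanceAs (Finite (c.Label ⊕ d.Label))
  | loop k body ih => exact inferInstanceAs (Finite (Option ((x : Γ k) × (body x).Label)))

/-- The label at which a program starts. -/
def Cmd.entry : (c : Cmd Γ) → c.Label
  | .skip => ()
  | .push _ _ => ()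
  | .seq c _ => Sum.inl c.entry
  | .loop _ _ => (none : Option _)

variable [DecidableEq K]

section

variable {Λ : Type}

/-- The machine for a program, if the labels are embedded by `ι` and the machine continues at
`exit`. -/
def Cmd.code : (c : Cmd Γ) → (c.Label → Λ) → Λ → c.Label →
    TM2.Stmt Γ Λ (Option ((k : K) × Γ k))
  | .skip, _, exit => fun _ => .goto fun _ => exit
  | .push k x, _, exit => fun _ => .push k (fun _ => x) (.goto fun _ => exit)
  | .seq c d, ι, exit => fun l => Sum.casesOn (motive := fun _ => _) l
      (c.code (fun l => ι (Sum.inl l)) (ι (Sum.inr d.entry)))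
      (d.code (fun l => ι (Sum.inr l)) exit)
  | .loop k body, ι, exit => fun l => Option.casesOn (motive := fun _ => _) l
      (.pop k (fun _ o => o.map (Sigma.mk k)) (.goto fun v => v.elim exit fun p =>
        -- The internal state holds the symbol just popped from the stack `k`, so the last branch is
        -- never taken.
        if h : p.1 = k then ι (some ⟨h ▸ p.2, (body (h ▸ p.2)).entry⟩) else exit))
      (fun p => (body p.1).code (fun l => ι (some ⟨p.1, l⟩)) (ι none) p.2)

/-- The configuration `b` is reached from the configuration `a` in `t` steps. -/
def Leads (m : Λ → TM2.Stmt Γ Λ (Option ((k : K) × Γ k))) (t : ℕ)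
    (a b : TM2.Cfg Γ Λ (Option ((k : K) × Γ k))) : Prop :=
  (flip Option.bind (TM2.step m))^[t] (some a) = some b

theorem Leads.trans {m : Λ → TM2.Stmt Γ Λ (Option ((k : K) × Γ k))} {s t : ℕ}
    {a b c : TM2.Cfg Γ Λ (Option ((k : K) × Γ k))} (h₁ : Leads m s a b) (h₂ : Leads m t b c) :
    Leads m (s + t) a c := by
  unfold Leads at *
  rw [add_comm, Function.iterate_add_apply, h₁, h₂]

end

/-- The program transforms the first store into the second one in the given number of steps. -/
inductive Runs : Cmd Γ → Store Γ → Store Γ → ℕ → Prop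
  | skip (S) : Runs .skip S S 1
  | push (S k x) : Runs (.push k x) S (Function.update S k (x :: S k)) 1
  | seq {c d S S' S'' s t} (h₁ : Runs c S S' s) (h₂ : Runs d S' S'' t) :
      Runs (.seq c d) S S'' (s + t)
  | loop_nil {k body S} (h : S k = []) : Runs (.loop k body) S S 1
  | loop_cons {k body S S' S'' x l s t} (h : S k = x :: l)
      (h₁ : Runs (body x) (Function.update S k l) S' s) (h₂ : Runs (.loop k body) S' S'' t) :
      Runs (.loop k body) S S'' (1 + s + t)

/-- Arbitrary embeddings of labels and arbitrary exits make the induction possible: the exit of the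
first program of a sequence is the entry of the second, and the exit of the body of a loop is its
test. The internal state matters only immediately after a pop, so its final value is left open. -/
theorem Runs.leads {c : Cmd Γ} {S S' : Store Γ} {t : ℕ} (h : Runs c S S' t) {Λ : Type}
    {m : Λ → TM2.Stmt Γ Λ (Option ((k : K) × Γ k))} {ι : c.Label → Λ} {exit : Λ}
    (hm : ∀ l, m (ι l) = c.code ι exit l) (v : Option ((k : K) × Γ k)) :
    ∃ v', Leads m t ⟨some (ι c.entry), v, S⟩ ⟨some exit, v', S'⟩ := by
  induction h generalizing v exit with
  | skip S =>
    refine ⟨v, ?_⟩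
    simp [Leads, flip, hm, Cmd.code]
  | push S k x =>
    refine ⟨v, ?_⟩
    simp [Leads, flip, hm, Cmd.code]
  | @seq c d S S' S'' s t h₁ h₂ ih₁ ih₂ =>
    obtain ⟨v₁, hv₁⟩ := ih₁ (ι := fun l => ι (Sum.inl l)) (exit := ι (Sum.inr d.entry))
      (fun l => hm (Sum.inl l)) v
    obtain ⟨v₂, hv₂⟩ := ih₂ (ι := fun l => ι (Sum.inr l)) (exit := exit)
      (fun l => hm (Sum.inr l)) v₁
    exact ⟨v₂, hv₁.trans hv₂⟩
  | @loop_nil k body S h =>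
    refine ⟨none, ?_⟩
    have h0 := hm (none : Option _)
    have h1 : Function.update S k [] = S := by
      rw [← h, Function.update_eq_self]
    simp only [Leads, flip, Function.iterate_one, Option.bind_some, Cmd.entry, TM2.step]
    rw [h0]
    simp [Cmd.code, h, h1]
  | @loop_cons k body S S' S'' x l s t h h₁ h₂ ih₁ ih₂ =>
    obtain ⟨v₁, hv₁⟩ := ih₁ (ι := fun l => ι (some ⟨x, l⟩)) (exit := ι (none : Option _))
      (fun l => hm (some ⟨x, l⟩)) (some ⟨k, x⟩)
    obtain ⟨v₂, hv₂⟩ := ih₂ hm v₁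
    refine ⟨v₂, Leads.trans (Leads.trans ?_ hv₁) hv₂⟩
    have h0 := hm (none : Option _)
    simp only [Leads, flip, Function.iterate_one, Option.bind_some, Cmd.entry, TM2.step]
    rw [h0]
    simp [Cmd.code, h]

/-! ### Time bounds -/

/-- The program transforms the first store into the second one in at most the given number of
steps. -/
def RunsIn (c : Cmd Γ) (S S' : Store Γ) (T : ℕ) : Prop :=
  ∃ t ≤ T, Runs c S S' t

theorem RunsIn.mono {c : Cmd Γ} {S S' : Store Γ} {T T' : ℕ} (h : RunsIn c S S' T)
    (hT : T ≤ T') : RunsIn c S S' T' :=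
  let ⟨t, ht, hr⟩ := h
  ⟨t, ht.trans hT, hr⟩

theorem RunsIn.skip (S : Store Γ) : RunsIn .skip S S 1 := ⟨1, le_rfl, .skip S⟩

theorem RunsIn.push {S S' : Store Γ} {k : K} {x : Γ k}
    (h : Function.update S k (x :: S k) = S') : RunsIn (.push k x) S S' 1 :=
  ⟨1, le_rfl, h ▸ .push S k x⟩

theorem RunsIn.seq {c d : Cmd Γ} {S S' S'' : Store Γ} {T T' : ℕ} (h₁ : RunsIn c S S' T)
    (h₂ : RunsIn d S' S'' T') : RunsIn (.seq c d) S S'' (T + T') :=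
  let ⟨s, hs, hr⟩ := h₁
  let ⟨t, ht, hr'⟩ := h₂
  ⟨s + t, add_le_add hs ht, .seq hr hr'⟩

theorem RunsIn.loop_nil {k : K} {body : Γ k → Cmd Γ} {S : Store Γ} (h : S k = []) :
    RunsIn (.loop k body) S S 1 := ⟨1, le_rfl, .loop_nil h⟩

theorem RunsIn.loop_cons {k : K} {body : Γ k → Cmd Γ} {S S' S'' : Store Γ} {x : Γ k}
    {l : List (Γ k)} {T T' : ℕ} (h : S k = x :: l)
    (h₁ : RunsIn (body x) (Function.update S k l) S' T) (h₂ : RunsIn (.loop k body) S' S'' T') :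
    RunsIn (.loop k body) S S'' (1 + T + T') :=
  let ⟨s, hs, hr⟩ := h₁
  let ⟨t, ht, hr'⟩ := h₂
  ⟨1 + s + t, by omega, .loop_cons h hr hr'⟩

/-- A loop that is run `n` times. -/
theorem RunsIn.loop {k : K} {body : Γ k → Cmd Γ} (S : ℕ → Store Γ) {n T : ℕ} (h0 : S 0 k = [])
    (hS : ∀ i < n, ∃ x l, S (i + 1) k = x :: l ∧
      RunsIn (body x) (Function.update (S (i + 1)) k l) (S i) T) :
    RunsIn (.loop k body) (S n) (S 0) (n * (T + 1) + 1) := by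
  induction n with
  | zero => exact (RunsIn.loop_nil h0).mono (by simp)
  | succ n ih =>
    obtain ⟨x, l, hx, hr⟩ := hS n (by omega)
    exact (RunsIn.loop_cons hx hr (ih fun i hi => hS i (by omega))).mono
      (by rw [Nat.succ_mul]; omega)

/-! ### The machine for a program -/

/-- The machine that executes a program and halts. -/
noncomputable def machine [Fintype K] [∀ k, Finite (Γ k)] (c : Cmd Γ) (k₀ k₁ : K) : FinTM2 where
  K := K
  k₀ := k₀
  k₁ := k₁
  Γ := Γ
  Λ := Option c.Label
  main := some c.entry
  ΛFin := @Fintype.ofFinite _ (by have := c.finite_label; infer_instance)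
  σ := Option ((k : K) × Γ k)
  initialState := none
  σFin := Fintype.ofFinite _
  Γk₀Fin := Fintype.ofFinite _
  -- A halting configuration has to be in the initial internal state, which is therefore restored
  -- before halting.
  m l := l.elim (.load (fun _ => none) .halt) (c.code some none)

/-- The store in which all stacks except `k` are empty. -/
def single (k : K) (l : List (Γ k)) : Store Γ := Function.update (fun _ => []) k l

theorem initList_machine [Fintype K] [∀ k, Finite (Γ k)] (c : Cmd Γ) (k₀ k₁ : K)
    (l : List (Γ k₀)) :
    initList (machine c k₀ k₁) l = ⟨some (some c.entry), none, single k₀ l⟩ := by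
  refine congrArg (TM2.Cfg.mk _ _) (funext fun (k : K) => ?_)
  by_cases h : k = k₀
  · cases h
    exact (dif_pos rfl).trans (Function.update_self k₀ l fun _ => []).symm
  · exact (dif_neg h).trans (Function.update_of_ne h l fun _ => []).symm

theorem haltList_machine [Fintype K] [∀ k, Finite (Γ k)] (c : Cmd Γ) (k₀ k₁ : K)
    (l : List (Γ k₁)) :
    haltList (machine c k₀ k₁) l = ⟨none, none, single k₁ l⟩ := by
  refine congrArg (TM2.Cfg.mk _ _) (funext fun (k : K) => ?_)
  by_cases h : k = k₁
  · cases h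
    exact (dif_pos rfl).trans (Function.update_self k₁ l fun _ => []).symm
  · exact (dif_neg h).trans (Function.update_of_ne h l fun _ => []).symm

theorem outputsInTime [Fintype K] [∀ k, Finite (Γ k)] {c : Cmd Γ} {k₀ k₁ : K}
    {l : List (Γ k₀)} {l' : List (Γ k₁)} {T : ℕ} (h : RunsIn c (single k₀ l) (single k₁ l') T) :
    Nonempty (TM2OutputsInTime (machine c k₀ k₁) l (some l') (T + 1)) := by
  obtain ⟨t, ht, hr⟩ := h
  obtain ⟨v, hv⟩ := hr.leads (m := (machine c k₀ k₁).m) (ι := some) (exit := none)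
    (fun l => rfl) none
  have hlast : Leads (machine c k₀ k₁).m 1 ⟨some none, v, single k₁ l'⟩
      ⟨none, none, single k₁ l'⟩ := rfl
  refine ⟨⟨⟨t + 1, ?_⟩, Nat.succ_le_succ ht⟩⟩
  rw [initList_machine]
  exact Eq.trans (hv.trans hlast) (congrArg some (haltList_machine c k₀ k₁ l').symm)

end StackProgram

namespace AbsDL

open StackProgram

/-! ### A program for the reduction -/

/-- The stacks of the program: the input, its reversal, the output and four counters. -/
inductive Stk : Type
  | inp | rev | out | base | power | aux₁ | aux₂
  deriving DecidableEq

instance : Fintype Stk where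
  elems := {.inp, .rev, .out, .base, .power, .aux₁, .aux₂}
  complete k := by cases k <;> simp

/-- The stack alphabets. -/
abbrev Alph (α : Type) : Stk → Type
  | .inp => α
  | .rev => α
  | .out => Sym
  | _ => Unit

variable {α : Type}

instance [Finite α] : ∀ k, Finite (Alph α k)
  | .inp => inferInstanceAs (Finite α)
  | .rev => inferInstanceAs (Finite α)
  | .out => inferInstanceAs (Finite Sym)
  | .base => inferInstanceAs (Finite Unit)
  | .power => inferInstanceAs (Finite Unit)
  | .aux₁ => inferInstanceAs (Finite Unit)
  | .aux₂ => inferInstanceAs (Finite Unit)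

/-- The store with the given stack contents. -/
def store (i r : List α) (o : List Sym) (u v w x : ℕ) : Store (Alph α)
  | .inp => i
  | .rev => r
  | .out => o
  | .base => List.replicate u ()
  | .power => List.replicate v ()
  | .aux₁ => List.replicate w ()
  | .aux₂ => List.replicate x ()

/-! ### Effect of single pushes on the store -/

section Store

variable {i r : List α} {o : List Sym} {u v w x : ℕ}

theorem update_inp (l : List α) :
    Function.update (store i r o u v w x) .inp l = store l r o u v w x := by
  funext k; cases k <;> rfl

theorem update_rev (l : List α) :
    Function.update (store i r o u v w x) .rev l = store i l o u v w x := by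
  funext k; cases k <;> rfl

theorem update_out (l : List Sym) :
    Function.update (store i r o u v w x) .out l = store i r l u v w x := by
  funext k; cases k <;> rfl

theorem update_base (n : ℕ) : Function.update (store i r o u v w x) .base
    (List.replicate n () : List Unit) = store i r o n v w x := by
  funext k; cases k <;> rfl

theorem update_power (n : ℕ) : Function.update (store i r o u v w x) .power
    (List.replicate n () : List Unit) = store i r o u n w x := by
  funext k; cases k <;> rfl

theorem update_aux₁ (n : ℕ) : Function.update (store i r o u v w x) .aux₁
    (List.replicate n () : List Unit) = store i r o u v n x := by
  funext k; cases k <;> rfl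

theorem update_aux₂ (n : ℕ) : Function.update (store i r o u v w x) .aux₂
    (List.replicate n () : List Unit) = store i r o u v w n := by
  funext k; cases k <;> rfl

variable (i r o u v w x)

theorem runsIn_push_rev (a : α) : RunsIn (.push (Γ := Alph α) .rev a) (store i r o u v w x)
    (store i (a :: r) o u v w x) 1 := .push (update_rev _)

theorem runsIn_push_out (a : Sym) : RunsIn (.push (Γ := Alph α) .out a) (store i r o u v w x)
    (store i r (a :: o) u v w x) 1 := .push (update_out _)

theorem runsIn_push_base : RunsIn (.push (Γ := Alph α) .base ()) (store i r o u v w x)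
    (store i r o (u + 1) v w x) 1 := .push (update_base (u + 1))

theorem runsIn_push_power : RunsIn (.push (Γ := Alph α) .power ()) (store i r o u v w x)
    (store i r o u (v + 1) w x) 1 := .push (update_power (v + 1))

theorem runsIn_push_aux₁ : RunsIn (.push (Γ := Alph α) .aux₁ ()) (store i r o u v w x)
    (store i r o u v (w + 1) x) 1 := .push (update_aux₁ (w + 1))

theorem runsIn_push_aux₂ : RunsIn (.push (Γ := Alph α) .aux₂ ()) (store i r o u v w x)
    (store i r o u v w (x + 1)) 1 := .push (update_aux₂ (x + 1))

end Store

/-- Puts a word in front of the output. -/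
def pushes : List Sym → Cmd (Alph α)
  | [] => .skip
  | a :: l => .seq (pushes l) (.push .out a)

theorem runsIn_pushes (l : List Sym) (i r : List α) (o : List Sym) (u v w x : ℕ) :
    RunsIn (pushes l) (store i r o u v w x) (store i r (l ++ o) u v w x) (l.length + 1) := by
  induction l with
  | nil => exact .skip _
  | cons a l ih => exact ih.seq (runsIn_push_out ..)

/-! ### Output of words that depend on a counter -/

/-- Parts of the output: fixed words and names of levels. -/
inductive Item : Type
  | str (l : List Sym)
  | idx

/-- The word for an item if the counter has the value `n`. -/
def Item.value (n : ℕ) : Item → List Sym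
  | .str l => l
  | .idx => encodeName (unary n)

/-- The program that outputs an item. -/
def Item.emit : Item → Cmd (Alph α)
  | .str l => pushes l
  | .idx => .seq (.push .out Sym.fin) (.seq
      (.loop .power fun _ => .seq (.push .aux₂ ()) (.push .out (Sym.bit true)))
      (.loop .aux₂ fun _ => .push .power ()))

/-- A bound for the time needed to output an item, relative to the value of the counter. -/
def Item.cost : Item → ℕ
  | .str l => l.length + 1
  | .idx => 5

theorem encodeName_unary (n : ℕ) :
    encodeName (unary n) = List.replicate n (Sym.bit true) ++ [Sym.fin] := by
  simp [encodeName, unary]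

theorem Item.runsIn_emit (a : Item) (i r : List α) (o : List Sym) (u v : ℕ) :
    RunsIn a.emit (store i r o u v 0 0) (store i r (a.value v ++ o) u v 0 0)
      (a.cost * (v + 1)) := by
  cases a with
  | str l => exact (runsIn_pushes ..).mono (Nat.le_mul_of_pos_right _ v.succ_pos)
  | idx =>
    -- Output empties the counter; it is saved in `aux₂` meanwhile and restored by the second loop.
    have h₁ := RunsIn.loop (k := Stk.power) (n := v) (T := 1 + 1)
      (body := fun _ => .seq (.push .aux₂ ()) (.push .out (Sym.bit true)))
      (fun j => store i r (List.replicate (v - j) (Sym.bit true) ++ Sym.fin :: o) u j 0 (v - j))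
      rfl fun j hj => ⟨(), List.replicate j (), rfl, by
        rw [update_power, show v - j = v - (j + 1) + 1 by omega]
        exact (runsIn_push_aux₂ ..).seq (runsIn_push_out ..)⟩
    have h₂ := RunsIn.loop (k := Stk.aux₂) (n := v) (T := 1)
      (body := fun _ => .push .power ())
      (fun j => store i r (List.replicate v (Sym.bit true) ++ Sym.fin :: o) u (v - j) 0 j)
      rfl fun j hj => ⟨(), List.replicate j (), rfl, by
        rw [update_aux₂, show v - j = v - (j + 1) + 1 by omega]
        exact runsIn_push_power ..⟩
    simp only [Nat.sub_self, List.replicate_zero, List.nil_append, Nat.sub_zero] at h₁ h₂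
    have h := (runsIn_push_out i r o u v 0 0 Sym.fin).seq (h₁.seq h₂)
    rw [Item.value, encodeName_unary, List.append_assoc, List.singleton_append]
    exact h.mono (by simp only [Item.cost]; omega)

/-- The word for a list of items. -/
def scriptValue (s : List Item) (n : ℕ) : List Sym := s.flatMap (Item.value n)

/-- The program that outputs a list of items. -/
def emitScript : List Item → Cmd (Alph α)
  | [] => .skip
  | a :: s => .seq (emitScript s) a.emit

/-- A bound for the time needed to output a list of items. -/
def scriptCost : List Item → ℕ
  | [] => 1
  | a :: s => scriptCost s + a.cost

theorem runsIn_emitScript (s : List Item) (i r : List α) (o : List Sym) (u v : ℕ) :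
    RunsIn (emitScript s) (store i r o u v 0 0) (store i r (scriptValue s v ++ o) u v 0 0)
      (scriptCost s * (v + 1)) := by
  induction s with
  | nil => exact (RunsIn.skip _).mono (by simp [scriptCost])
  | cons a s ih =>
    have := ih.seq (a.runsIn_emit i r (scriptValue s v ++ o) u v)
    rw [← List.append_assoc] at this
    exact this.mono (by simp only [scriptCost]; rw [add_mul])

/-- The program that outputs a list of items for all smaller values of the counter. -/
def emitLevels (s : List Item) : Cmd (Alph α) :=
  .loop .power fun _ => emitScript s

/-- The counter runs downwards, from `v - 1` to `0`, and each word is put in front of the output, so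
the blocks appear in increasing order. -/
theorem runsIn_emitLevels (s : List Item) (i r : List α) (o : List Sym) (u v : ℕ) :
    RunsIn (emitLevels s) (store i r o u v 0 0)
      (store i r ((List.range v).flatMap (scriptValue s) ++ o) u 0 0 0)
      (v * (scriptCost s * (v + 1) + 1) + 1) := by
  have h := RunsIn.loop (k := Stk.power) (n := v) (T := scriptCost s * (v + 1))
    (body := fun _ => emitScript s)
    (fun j => store i r (((List.range v).drop j).flatMap (scriptValue s) ++ o) u j 0 0)
    rfl fun j hj => ⟨(), List.replicate j (), rfl, by
      rw [update_power, List.drop_eq_getElem_cons (i := j) (by simpa using hj), List.getElem_range,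
        List.flatMap_cons, List.append_assoc]
      exact (runsIn_emitScript s i r _ u j).mono (Nat.mul_le_mul_left _ (by omega))⟩
  simpa [List.drop_eq_nil_of_le, emitLevels] using h

/-! ### Computing a power -/

/-- Multiplies the counter `power` by the counter `base`. -/
def multiply : Cmd (Alph α) :=
  .seq (.loop .power fun _ => .seq
      (.loop .base fun _ => .seq (.push .aux₂ ()) (.push .aux₁ ()))
      (.loop .aux₂ fun _ => .push .base ()))
    (.loop .aux₁ fun _ => .push .power ())

theorem runsIn_multiply (i r : List α) (o : List Sym) (u v : ℕ) :
    RunsIn multiply (store i r o u v 0 0) (store i r o u (v * u) 0 0)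
      (7 * (v * u) + 3 * v + 2) := by
  have body : ∀ j w, RunsIn (.seq
      (.loop .base fun _ => .seq (.push .aux₂ ()) (.push .aux₁ ()))
      (.loop .aux₂ fun _ => .push .base ())) (store i r o u j w 0) (store i r o u j (w + u) 0)
      (5 * u + 2) := by
    intro j w
    have h₁ := RunsIn.loop (k := Stk.base) (n := u) (T := 1 + 1)
      (body := fun _ => .seq (.push .aux₂ ()) (.push .aux₁ ()))
      (fun a => store i r o a j (w + (u - a)) (u - a))
      rfl fun a ha => ⟨(), List.replicate a (), rfl, by
        rw [update_base, show u - a = u - (a + 1) + 1 by omega, ← add_assoc]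
        exact (runsIn_push_aux₂ ..).seq (runsIn_push_aux₁ ..)⟩
    have h₂ := RunsIn.loop (k := Stk.aux₂) (n := u) (T := 1)
      (body := fun _ => .push .base ())
      (fun a => store i r o (u - a) j (w + u) a)
      rfl fun a ha => ⟨(), List.replicate a (), rfl, by
        rw [update_aux₂, show u - a = u - (a + 1) + 1 by omega]
        exact runsIn_push_base ..⟩
    simp only [Nat.sub_self, Nat.sub_zero, add_zero] at h₁ h₂
    exact (h₁.seq h₂).mono (by omega)
  have h₁ := RunsIn.loop (k := Stk.power) (n := v) (T := 5 * u + 2)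
    (body := fun _ => .seq
      (.loop .base fun _ => .seq (.push .aux₂ ()) (.push .aux₁ ()))
      (.loop .aux₂ fun _ => .push .base ()))
    -- When `j` rounds remain, `aux₁` holds the product accumulated in the other `v - j` rounds.
    (fun j => store i r o u j ((v - j) * u) 0)
    rfl fun j hj => ⟨(), List.replicate j (), rfl, by
      rw [update_power, show v - j = v - (j + 1) + 1 by omega, add_mul, one_mul]
      exact body _ _⟩
  have h₂ := RunsIn.loop (k := Stk.aux₁) (n := v * u) (T := 1)
    (body := fun _ => .push .power ())
    (fun a => store i r o u (v * u - a) a 0)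
    rfl fun a ha => ⟨(), List.replicate a (), rfl, by
      rw [update_aux₁, show v * u - a = v * u - (a + 1) + 1 by omega]
      exact runsIn_push_power ..⟩
  simp only [Nat.sub_self, Nat.sub_zero, zero_mul] at h₁ h₂
  exact (h₁.seq h₂).mono (by ring_nf; omega)

/-- Multiplies the counter `power` by the `k`-th power of the counter `base`. -/
def multiplyPow : ℕ → Cmd (Alph α)
  | 0 => .skip
  | k + 1 => .seq (multiplyPow k) multiply

theorem runsIn_multiplyPow (k : ℕ) (i r : List α) (o : List Sym) {u : ℕ} (hu : 0 < u) :
    RunsIn (multiplyPow k) (store i r o u 1 0 0) (store i r o u (u ^ k) 0 0)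
      (12 * k * u ^ k + 1) := by
  induction k with
  | zero => simpa [multiplyPow] using RunsIn.skip _
  | succ k ih =>
    have h := ih.seq (runsIn_multiply i r o u (u ^ k))
    rw [← pow_succ] at h
    refine h.mono ?_
    -- One multiplication costs at most `7 + 3 + 2 = 12` times `u ^ (k + 1)`.
    have h₁ : u ^ k ≤ u ^ (k + 1) := Nat.pow_le_pow_right hu k.le_succ
    have h₂ : 0 < u ^ (k + 1) := by positivity
    have h₃ : k * u ^ k ≤ k * u ^ (k + 1) := Nat.mul_le_mul_left _ h₁
    calc 12 * k * u ^ k + 1 + (7 * u ^ (k + 1) + 3 * u ^ k + 2)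
        = 12 * (k * u ^ k) + 1 + (7 * u ^ (k + 1) + 3 * u ^ k + 2) := by ring
      _ ≤ 12 * (k * u ^ (k + 1)) + 12 * u ^ (k + 1) + 1 := by omega
      _ = 12 * (k + 1) * u ^ (k + 1) + 1 := by ring

/-! ### The whole program -/

/-- Reverses the input and counts its letters. -/
def readInput : Cmd (Alph α) :=
  .loop .inp fun a => .seq (.push .rev a) (.push .base ())

theorem runsIn_readInput (l r : List α) (o : List Sym) (u v w x : ℕ) :
    RunsIn readInput (store l r o u v w x) (store [] (l.reverse ++ r) o (u + l.length) v w x)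
      (3 * l.length + 1) := by
  induction l generalizing r u with
  | nil => exact RunsIn.loop_nil rfl
  | cons a l ih =>
    have h := ih (a :: r) (u + 1)
    rw [show u + 1 + l.length = u + (a :: l).length by simp; ring,
      show l.reverse ++ a :: r = (a :: l).reverse ++ r by simp] at h
    refine (RunsIn.loop_cons (l := l) rfl ?_ h (T := 1 + 1)).mono (by simp; omega)
    rw [update_inp]
    exact (runsIn_push_rev ..).seq (runsIn_push_base ..)

/-- Outputs a word for each letter of the input. -/
def emitLetters (f : α → List Sym) : Cmd (Alph α) :=
  .loop .rev fun a => pushes (f a)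

theorem runsIn_emitLetters {f : α → List Sym} {c : ℕ} (hf : ∀ a, (f a).length ≤ c)
    (i l : List α) (o : List Sym) (u v w x : ℕ) :
    RunsIn (emitLetters f) (store i l o u v w x)
      (store i [] (l.reverse.flatMap f ++ o) u v w x) ((c + 2) * l.length + 1) := by
  induction l generalizing o with
  | nil => exact RunsIn.loop_nil rfl
  | cons a l ih =>
    have h := ih (f a ++ o)
    rw [show l.reverse.flatMap f ++ (f a ++ o) = (a :: l).reverse.flatMap f ++ o by simp] at h
    refine (RunsIn.loop_cons (l := l) rfl ?_ h (T := c + 1)).mono ?_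
    · rw [update_rev]
      exact (runsIn_pushes ..).mono (by have := hf a; omega)
    · rw [List.length_cons, mul_add]
      omega

/-- The program that outputs `s`, the levels according to `block`, the items `top`, a word for each
letter of the input, and the items `bot`. -/
def mainProgram (k : ℕ) (s : List Sym) (block top bot : List Item) (f : α → List Sym) :
    Cmd (Alph α) :=
  .seq readInput <| .seq (.push .base ()) <| .seq (.push .base ()) <| .seq (.push .power ()) <|
    .seq (multiplyPow k) <| .seq (.loop .base fun _ => .skip) <| .seq (emitScript bot) <|
    .seq (emitLetters f) <| .seq (emitScript top) <| .seq (emitLevels block) (pushes s)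

/-- The output stack is filled from its bottom, so the word is produced from its last part to its
first. Reversing the input lets its last letter be treated first. The two extra pushes on `base`
turn the length into the base of the power, and all stacks except the output end up empty, as
required of the final configuration. -/
theorem runsIn_mainProgram (k : ℕ) (s : List Sym) (block top bot : List Item)
    {f : α → List Sym} {c : ℕ} (hf : ∀ a, (f a).length ≤ c) (l : List α) :
    RunsIn (mainProgram k s block top bot f) (store l [] [] 0 0 0 0)
      (store [] [] (s ++ ((List.range ((l.length + 2) ^ k)).flatMap (scriptValue block) ++
        (scriptValue top ((l.length + 2) ^ k) ++ (l.flatMap f ++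
          scriptValue bot ((l.length + 2) ^ k))))) 0 0 0 0)
      (3 * l.length + 1 + (1 + (1 + (1 + (12 * k * (l.length + 2) ^ k + 1 +
        ((l.length + 2) * (1 + 1) + 1 + (scriptCost bot * ((l.length + 2) ^ k + 1) +
          ((c + 2) * l.length + 1 + (scriptCost top * ((l.length + 2) ^ k + 1) +
            ((l.length + 2) ^ k * (scriptCost block * ((l.length + 2) ^ k + 1) + 1) + 1 +
              (s.length + 1)))))))))) ) := by
  have hclear : ∀ (r : List α) (u v : ℕ), RunsIn (.loop .base fun _ => .skip)
      (store [] r [] u v 0 0) (store [] r [] 0 v 0 0) (u * (1 + 1) + 1) := fun r u v =>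
    RunsIn.loop (k := Stk.base) (fun j => store [] r [] j v 0 0) rfl fun j hj =>
      ⟨(), List.replicate j (), rfl, by
        rw [update_base]
        exact .skip _⟩
  have h₁ := runsIn_readInput l [] [] 0 0 0 0
  rw [zero_add, List.append_nil] at h₁
  have h₂ := runsIn_emitLetters hf [] l.reverse (scriptValue bot ((l.length + 2) ^ k)) 0
    ((l.length + 2) ^ k) 0 0
  rw [List.reverse_reverse, List.length_reverse] at h₂
  have h₃ := runsIn_emitScript bot [] l.reverse [] 0 ((l.length + 2) ^ k)
  rw [List.append_nil] at h₃
  exact h₁.seq <| (runsIn_push_base ..).seq <| (runsIn_push_base ..).seq <|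
    (runsIn_push_power ..).seq <| (runsIn_multiplyPow k _ _ _ (by omega)).seq <|
    (hclear _ _ _).seq <| h₃.seq <| h₂.seq <| (runsIn_emitScript ..).seq <|
    (runsIn_emitLevels ..).seq (runsIn_pushes ..)

end AbsDL

namespace AbsDL

open StackProgram Turing

/-! ### The encoding of the instances as output of the program -/

variable {Γ S : Type}

theorem scriptValue_append (s t : List Item) (n : ℕ) :
    scriptValue (s ++ t) n = scriptValue s n ++ scriptValue t n := List.flatMap_append

theorem scriptValue_flatMap {β : Type} (l : List β) (g : β → List Item) (n : ℕ) :
    scriptValue (l.flatMap g) n = l.flatMap fun b => scriptValue (g b) n := List.flatMap_assoc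

/-- The items for a rule between consecutive levels. -/
def Rule.script (R : Rule) : List Item :=
  [.str [Sym.next, Sym.roleRefinement], .idx, .str (encodeCQ R.q ++ [Sym.bit true]), .idx,
    .str (encodeConcept R.source ++ (encodeName R.role ++ encodeConcept R.target))]

theorem Rule.scriptValue_script (R : Rule) (i : ℕ) :
    scriptValue R.script i = Sym.next :: encodeStatement (R.toStatement i) := by
  -- With unary names, the name of the next level needs just one more symbol in front, so a single
  -- counter serves both levels of a rule.
  have : encodeName (unary (i + 1)) = Sym.bit true :: encodeName (unary i) := rfl
  simp [scriptValue, Rule.script, Item.value, encodeStatement, Rule.toStatement, this]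

/-- The items for the first part of a concept inclusion. -/
def inclusionScript (l : List Sym) : List Item :=
  [.str [Sym.next, Sym.inclusion], .idx, .str l]

theorem scriptValue_inclusionScript (C D : Concept) (l : List Sym) (i : ℕ) :
    Sym.next :: encodeStatement (inclusionAt i (C, D)) ++ l =
      scriptValue (inclusionScript (encodeConcept C)) i ++ (encodeConcept D ++ l) := by
  simp [scriptValue, inclusionScript, Item.value, encodeStatement, inclusionAt]

/-- The code of an instance with many levels. -/
theorem encodeInstance_layered (bots : List (Concept × Concept)) (R : List Rule)
    (tops : List (Concept × Concept)) (B D C : Concept) (N : ℕ) :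
    encodeInstance (layered bots R tops (B, D) C N) =
      bots.flatMap (fun p => Sym.next :: encodeStatement (inclusionAt 0 p)) ++
        ((List.range N).flatMap (scriptValue (R.flatMap Rule.script)) ++
          (scriptValue (tops.flatMap (fun p =>
              inclusionScript (encodeConcept p.1 ++ encodeConcept p.2)) ++
            inclusionScript (encodeConcept B)) N ++ (encodeConcept D ++
              scriptValue [.str (Sym.fin :: encodeConcept C), .idx] N))) := by
  have h₁ : ∀ i, scriptValue (R.flatMap Rule.script) i =
      R.flatMap fun r => Sym.next :: encodeStatement (r.toStatement i) := fun i => by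
    simp only [scriptValue_flatMap, Rule.scriptValue_script]
  have h₂ : ∀ p : Concept × Concept,
      scriptValue (inclusionScript (encodeConcept p.1 ++ encodeConcept p.2)) N =
        Sym.next :: encodeStatement (inclusionAt N p) := fun p => by
    simp [scriptValue, inclusionScript, Item.value, encodeStatement, inclusionAt]
  rw [funext h₁, scriptValue_append, scriptValue_flatMap]
  simp only [h₂]
  have h₃ := scriptValue_inclusionScript B D
    (Sym.fin :: (encodeConcept C ++ encodeName (unary N))) N
  simp only [encodeInstance, layered, encodeList, List.flatMap_append, List.flatMap_map,
    List.flatMap_assoc, List.flatMap_cons, List.flatMap_nil, List.append_assoc, List.append_nil,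
    List.singleton_append]
  rw [h₃]
  simp [scriptValue, Item.value]

/-! ### The input-dependent concept and the running time of the reduction -/

section Input

variable (S) [Finite Γ] [Finite S]

/-- The part of the code of `inputC` that belongs to a letter. -/
noncomputable def inputWord (a : Γ) : List Sym :=
  Sym.union :: (encodeConcept (.inter (nmC (Sig.zero true : Sig Γ S))
      (nmC (Sig.sym a : Sig Γ S))) ++
    Sym.inter :: (encodeConcept (nmC (Sig.pos true : Sig Γ S)) ++ Sym.ex :: (encodeName row ++
      Sym.inter :: (encodeConcept (nmC (Sig.dec true : Sig Γ S)) ++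
        Sym.inter :: encodeConcept (nmC (Sig.walk : Sig Γ S))))))

/-- In prefix notation the concept for the remaining input comes last, with nothing to close after
it, so each letter contributes a contiguous word. -/
theorem encodeConcept_inputC (blank : Γ) (u : List Γ) : encodeConcept (inputC S blank u) =
    u.flatMap (inputWord S) ++ encodeConcept (nmC (Sig.sym blank : Sig Γ S)) := by
  induction u with
  | nil => rfl
  | cons a u ih =>
    simp only [inputC, encodeConcept, ih, inputWord, List.flatMap_cons, List.append_assoc,
      List.cons_append]

/-- The reduction is computable in polynomial time. -/
theorem nonempty_computableInPolyTime_reduction {α : Type} [Finite α] (A : Automaton Γ S)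
    (F : Set S) (sym : α → Γ) (k : ℕ) :
    Nonempty (TM2ComputableInPolyTime (id : List α → List α) encodeInstance fun w =>
      reduction A F (w.map sym) ((w.length + 2) ^ k)) := by
  obtain ⟨c, hc⟩ := Finite.exists_le fun a : α => (inputWord S (sym a)).length
  set s := (bottomInclusions Γ S).flatMap
    fun p => Sym.next :: encodeStatement (inclusionAt 0 p)
  set block := (rules Γ S).flatMap Rule.script
  set top := (topInclusions A).flatMap (fun p =>
      inclusionScript (encodeConcept p.1 ++ encodeConcept p.2)) ++
    inclusionScript (encodeConcept (nmC (Sig.start : Sig Γ S)))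
  set bot := [Item.str (encodeConcept (nmC (Sig.sym A.blank : Sig Γ S))),
    .str (Sym.fin :: encodeConcept (queryC Γ F)), .idx]
  have hcode : ∀ w : List α, encodeInstance (reduction A F (w.map sym) ((w.length + 2) ^ k)) =
      s ++ ((List.range ((w.length + 2) ^ k)).flatMap (scriptValue block) ++
        (scriptValue top ((w.length + 2) ^ k) ++ (w.flatMap (fun a => inputWord S (sym a)) ++
          scriptValue bot ((w.length + 2) ^ k)))) := fun w => by
    rw [reduction, encodeInstance_layered, encodeConcept_inputC, List.flatMap_map,
      List.append_assoc]
    rfl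
  refine ⟨{
    tm := machine (mainProgram k s block top bot fun a => inputWord S (sym a)) Stk.inp Stk.out
    inputAlphabet := Equiv.refl α
    outputAlphabet := Equiv.refl Sym
    time := 3 * .X + 1 + (1 + (1 + (1 + (12 * (k : Polynomial ℕ) * (.X + 2) ^ k + 1 +
        ((.X + 2) * (1 + 1) + 1 + ((scriptCost bot : Polynomial ℕ) * ((.X + 2) ^ k + 1) +
          (((c : Polynomial ℕ) + 2) * .X + 1 +
            ((scriptCost top : Polynomial ℕ) * ((.X + 2) ^ k + 1) +
              ((.X + 2) ^ k * ((scriptCost block : Polynomial ℕ) * ((.X + 2) ^ k + 1) + 1) + 1 +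
                ((s.length : Polynomial ℕ) + 1)))))))))) + 1
    outputsFun := fun w => Classical.choice ?_ }⟩
  have h := runsIn_mainProgram k s block top bot hc w
  rw [← hcode] at h
  have h₁ : ∀ l : List α, store l [] [] 0 0 0 0 = single Stk.inp l := fun l => by
    funext k; cases k <;> rfl
  have h₂ : ∀ l : List Sym, store [] [] l 0 0 0 0 = single (Γ := Alph α) Stk.out l := fun l => by
    funext k; cases k <;> rfl
  rw [h₁, h₂] at h
  have h₃ := outputsInTime h
  have e₁ : List.map (Equiv.refl α).invFun (id w) = w := List.map_id w
  have e₂ : ∀ l : List Sym, List.map (Equiv.refl Sym).invFun l = l := List.map_id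
  rw [show ∀ q : Polynomial ℕ, q.eval (id w).length = q.eval w.length from fun _ => rfl]
  simp only [Polynomial.eval_add, Polynomial.eval_mul, Polynomial.eval_pow, Polynomial.eval_X,
    Polynomial.eval_natCast, Polynomial.eval_ofNat, Polynomial.eval_one, Nat.cast_id]
  exact e₁.symm ▸ (e₂ _).symm ▸ h₃

end Input

/-! ### Polynomial bounds -/

/-- Every polynomial is bounded by a power of `n + 2`. -/
theorem exists_eval_le_pow (p : Polynomial ℕ) : ∃ k, ∀ n, p.eval n ≤ (n + 2) ^ k := by
  induction p using Polynomial.induction_on' with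
  | add p q hp hq =>
    obtain ⟨a, ha⟩ := hp
    obtain ⟨b, hb⟩ := hq
    refine ⟨max a b + 1, fun n => ?_⟩
    have h₁ := (ha n).trans (Nat.pow_le_pow_right (by omega : n + 2 > 0) (le_max_left a b))
    have h₂ := (hb n).trans (Nat.pow_le_pow_right (by omega : n + 2 > 0) (le_max_right a b))
    rw [Polynomial.eval_add, pow_succ]
    nlinarith
  | monomial m a =>
    refine ⟨a + m, fun n => ?_⟩
    rw [Polynomial.eval_monomial, pow_add]
    -- The coefficient is bounded by `a ≤ 2 ^ a ≤ (n + 2) ^ a`.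
    exact Nat.mul_le_mul (Nat.lt_two_pow_self.le.trans (Nat.pow_le_pow_left (by omega) a))
      (Nat.pow_le_pow_left (by omega) m)

/-- Both summands are at most `2 ^ 2 ^ (P + n)`, the second strictly smaller, so the left side is
below `2 ^ (2 ^ (P + n) + 2)`; raising the upper exponent by two absorbs the additional `2`. -/
theorem two_mul_lt_two_pow_two_pow {P n N : ℕ} (h : P + n + 2 ≤ N) :
    2 * (2 ^ 2 ^ P + n) < 2 ^ 2 ^ N := by
  have h₁ : n < 2 ^ 2 ^ (P + n) :=
    (Nat.lt_two_pow_self (n := n)).trans_le (Nat.pow_le_pow_right two_pos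
      ((Nat.le_add_left n P).trans Nat.lt_two_pow_self.le))
  have h₂ : 2 ^ 2 ^ P ≤ 2 ^ 2 ^ (P + n) :=
    Nat.pow_le_pow_right two_pos (Nat.pow_le_pow_right two_pos (Nat.le_add_right P n))
  have h₃ : 2 ^ (P + n) + 2 ≤ 2 ^ (P + n + 2) := by
    have : 1 ≤ 2 ^ (P + n) := Nat.one_le_two_pow
    rw [pow_add _ (P + n)]
    omega
  calc 2 * (2 ^ 2 ^ P + n) < 2 ^ (2 ^ (P + n) + 2) := by
        rw [pow_add]
        omega
    _ ≤ 2 ^ 2 ^ N := Nat.pow_le_pow_right two_pos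
        (h₃.trans (Nat.pow_le_pow_right two_pos h))

end AbsDL

/-- Satisfiability in ALC^abs[rr] is 2ExpTime-hard. -/
theorem theorem5 : TwoExpTimeHard AbsDL.encodeInstance AbsDL.Satisfiable := by
  rintro α _ L ⟨p, Γ, Λ, _, _, _, _, sym, M, acc, -, -, hM⟩
  -- The number of levels must be at least `p(n) + n + 2`, so that the cycle has more than `2 * B`
  -- cells for `B = 2 ^ 2 ^ p(n) + n`, a common bound for the running time and the length of the
  -- input.
  obtain ⟨k, hk⟩ := AbsDL.exists_eval_le_pow (p + .X + 2)
  refine ⟨_, AbsDL.nonempty_computableInPolyTime_reduction _ (AbsDL.machineAutomaton M)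
    (AbsDL.haltedIn M acc) sym k, fun w => ?_⟩
  obtain ⟨t, c, ht, hc, hhalt, hw⟩ := hM w
  have hN := hk w.length
  simp only [Polynomial.eval_add, Polynomial.eval_X, Polynomial.eval_ofNat] at hN
  have hB : 1 ≤ 2 ^ 2 ^ p.eval w.length := Nat.one_le_two_pow
  rw [← hw]
  exact (AbsDL.satisfiable_machineAutomaton_iff M acc (hB.trans (Nat.le_add_right _ _))
    (AbsDL.two_mul_lt_two_pow_two_pow hN) (by simp) (ht.trans (Nat.le_add_right _ _)) hc
    hhalt).symm
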